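/- Fix a convenient category of spaces: the category of $T$-generated topological spaces, where $T$ is a family of locally compact test spaces whose binary products are $T$-generated and such that the cubes $[0,1]^n$ are $T$-generated (for instance compactly generated or $\Delta$-generated spaces). Let $\mathcal{C}$ be a category enriched in these spaces, with mapping spaces $\mathrm{Map}(A,B)$, and let $h\mathcal{C}$ be its homotopy category, with $\mathrm{Hom}_{h\mathcal{C}}(A,B)=\pi_0\mathrm{Map}(A,B)$. Let $S$ be a class of morphisms of $\mathcal{C}$. An object $Y$ is *$S$-local* if $f^*\colon \mathrm{Map}(B,Y)\to\mathrm{Map}(A,Y)$ is a weak homotopy equivalence for every $f\colon A\to B$ in $S$; a map $f\colon A\to B$ is an *$S$-equivalence* if $f^*\colon \mathrm{Map}(B,Y)\to\mathrm{Map}(A,Y)$ is a weak homotopy equivalence for every $S$-local $Y$. For a functor $F$ from a small category $J$ to spaces, $\mathrm{holim}_J F$ is the Bousfield--Kan homotopy limit, i.e. the totalization of the cosimplicial space $[n]\mapsto\prod_{j_0\to\cdots\to j_n}F(j_n)$. A *homotopy limit* of a functor $Y\colon J\to\mathcal{C}$ is an object $L$ with a point of $\mathrm{holim}_J \mathrm{Map}(L,Y_j)$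 such that the induced natural map $\mathrm{Map}(X,L)\to\mathrm{holim}_J\mathrm{Map}(X,Y_j)$ is a weak equivalence for all $X$. A *homotopy colimit* of $X\colon I\to\mathcal{C}$ is an object $L$ with a point of $\mathrm{holim}_{I^{op}}\mathrm{Map}(X_i,L)$ such that the induced natural map $\mathrm{Map}(L,Y)\to\mathrm{holim}_{I^{op}}\mathrm{Map}(X_i,Y)$ is a weak equivalence for all $Y$. A square $f\colon A\to B$, $g\colon A\to A'$, $f'\colon A'\to B'$, $g'\colon B\to B'$ is a *homotopy pushout* if $f'$ and $g'$ are the components at $A'$ and $B$ of a point of $\mathrm{holim}$ exhibiting $B'$ as a homotopy colimit of $A'\xleftarrow{g}A\xrightarrow{f}B$. Then: 1. If $X$ and $Y$ are isomorphic in $h\mathcal{C}$ and $X$ is $S$-local, then $Y$ is $S$-local. 2. If the images in $h\mathcal{C}$ of two maps $f\colon A\to B$ and $f'\colon A'\to B'$ are isomorphic as arrows of $h\mathcal{C}$ and $f$ is an $S$-equivalence, then $f'$ is an $S$-equivalence. 3. If $L$ is a homotopy limit of a diagram $Y\colon J\to\mathcal{C}$ and every $Y_j$ is $S$-local, then $L$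 is $S$-local. 4. Let $\alpha\colon A\to B$ be a natural transformation of functors $I\to\mathcal{C}$ such that every $\alpha_i\colon A_i\to B_i$ is an $S$-equivalence, and let $A$ and $B$ have homotopy colimits. Then there is a map $\mathrm{hocolim}_I A\to\mathrm{hocolim}_I B$ induced by $\alpha$ (i.e. a map $f$ for which the points of $\mathrm{holim}_{I^{op}}\mathrm{Map}(A_i,\mathrm{hocolim}_I B)$ determined by $f$ and by $\alpha$ lie in the same path component), and every such map is an $S$-equivalence. 5. If the square $f\colon A\to B$, $g\colon A\to A'$, $f'\colon A'\to B'$, $g'\colon B\to B'$ is a homotopy pushout and $f$ is an $S$-equivalence, then $f'$ is an $S$-equivalence. 6. Given maps $A\xrightarrow{f}B\xrightarrow{g}D$, if any two of $f$, $g$ and $gf$ are $S$-equivalences, then so is the third. -/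

import Mathlib

open CategoryTheory CategoryTheory.Limits Opposite Topology

universe t s u v w w'

noncomputable section

namespace SpaceLocalization

/-! ### Weak homotopy equivalences -/

section WeakEquivalence

variable {X : Type u} {Y : Type v} [TopologicalSpace X] [TopologicalSpace Y]

/-- The map induced on path components. -/
def piZeroMap (f : C(X, Y)) : ZerothHomotopy X → ZerothHomotopy Y :=
  Quotient.map f fun _ _ h => Joined.map h f.continuous

/-- The map induced on generalized loops. -/
def genLoopMap (f : C(X, Y)) (N : Type) (x : X) (γ : GenLoop N X x) : GenLoop N Y (f x) :=
  ⟨f.comp γ.1, fun y hy => congrArg f (γ.2 y hy)⟩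

/-- The map induced on homotopy groups. -/
def homotopyGroupMap (f : C(X, Y)) (N : Type) (x : X) :
    HomotopyGroup N X x → HomotopyGroup N Y (f x) :=
  Quotient.map (genLoopMap f N x) fun _ _ h =>
    ContinuousMap.HomotopicRel.comp_continuousMap h f

/-- A function between topological spaces is a weak (homotopy) equivalence if it is continuous,
and bijective on path components and on all homotopy groups at all base points. -/
structure IsWeakEquiv (f : X → Y) : Prop where
  continuous : Continuous f
  bijective_piZero : Function.Bijective (piZeroMap ⟨f, continuous⟩)
  bijective_pi : ∀ (n : ℕ) (x : X),
    Function.Bijective (homotopyGroupMap ⟨f, continuous⟩ (Fin (n + 1)) x)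

end WeakEquivalence

/-! ### Categories enriched in a convenient category of spaces -/

/-- A family `T` of test spaces for which the category of `T`-generated spaces is a convenient
category of spaces: it is cartesian closed, because the test spaces are locally compact and their
binary products are `T`-generated, and it contains the cubes `[0,1]ⁿ`. Taking for `T` all the spaces
`ℝⁿ`, one gets the delta-generated spaces; taking all compact Hausdorff spaces, one gets the
compactly generated spaces. -/
class ConvenientFamily {ι : Type t} (T : ι → Type s) [∀ i, TopologicalSpace (T i)] : Prop where
  locallyCompact : ∀ i, LocallyCompactSpace (T i)
  prod : ∀ i j, IsGeneratedBy T (T i × T j)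
  cube : ∀ n : ℕ, IsGeneratedBy T (Fin n → unitInterval)

/-- A category whose hom-sets carry topologies is enriched in `T`-generated spaces if the hom-sets
are `T`-generated spaces and composition is continuous on the product of `T`-generated spaces
(whose topology is the `T`-generated topology associated to the usual product topology). -/
class SpaceEnriched {ι : Type t} (T : ι → Type s) [∀ i, TopologicalSpace (T i)]
    (C : Type u) [Category.{v} C] [∀ A B : C, TopologicalSpace (A ⟶ B)] : Prop where
  isGeneratedBy : ∀ A B : C, IsGeneratedBy T (A ⟶ B)
  continuousGeneratedBy_comp : ∀ A B D : C,
    ContinuousGeneratedBy T (fun p : (A ⟶ B) × (B ⟶ D) => p.1 ≫ p.2)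

section Enriched

theorem continuous_comp_of_isGeneratedBy {ι : Type t} (T : ι → Type s) [∀ i, TopologicalSpace (T i)]
    {C : Type u} [Category.{v} C] [∀ A B : C, TopologicalSpace (A ⟶ B)] [SpaceEnriched T C]
    {K : Type w} [TopologicalSpace K] [IsGeneratedBy T K]
    {A B D : C} {p : K → (A ⟶ B)} {q : K → (B ⟶ D)} (hp : Continuous p) (hq : Continuous q) :
    Continuous fun k => p k ≫ q k := by
  rw [IsGeneratedBy.continuous_iff T]
  intro i f
  exact SpaceEnriched.continuousGeneratedBy_comp A B D
    ⟨fun x => (p (f x), q (f x)), by fun_prop⟩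

theorem continuous_precomp {ι : Type t} (T : ι → Type s) [∀ i, TopologicalSpace (T i)]
    {C : Type u} [Category.{v} C] [∀ A B : C, TopologicalSpace (A ⟶ B)] [SpaceEnriched T C]
    {A B : C} (f : A ⟶ B) (Y : C) :
    Continuous fun g : B ⟶ Y => f ≫ g :=
  haveI := SpaceEnriched.isGeneratedBy (T := T) B Y
  continuous_comp_of_isGeneratedBy T continuous_const continuous_id

theorem continuous_postcomp {ι : Type t} (T : ι → Type s) [∀ i, TopologicalSpace (T i)]
    {C : Type u} [Category.{v} C] [∀ A B : C, TopologicalSpace (A ⟶ B)] [SpaceEnriched T C]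
    (X : C) {A B : C} (f : A ⟶ B) :
    Continuous fun g : X ⟶ A => g ≫ f :=
  haveI := SpaceEnriched.isGeneratedBy (T := T) X A
  continuous_comp_of_isGeneratedBy T continuous_id continuous_const

theorem isGeneratedBy_unitInterval {ι : Type t} (T : ι → Type s)
    [∀ i, TopologicalSpace (T i)] [ConvenientFamily T] : IsGeneratedBy T unitInterval :=
  haveI := ConvenientFamily.cube (T := T) 1
  (Homeomorph.funUnique (Fin 1) unitInterval).isQuotientMap.isGeneratedBy

theorem joined_comp {ι : Type t} (T : ι → Type s) [∀ i, TopologicalSpace (T i)]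
    {C : Type u} [Category.{v} C] [∀ A B : C, TopologicalSpace (A ⟶ B)] [SpaceEnriched T C]
    [ConvenientFamily T] {A B D : C} {f f' : A ⟶ B} {g g' : B ⟶ D}
    (hf : Joined f f') (hg : Joined g g') : Joined (f ≫ g) (f' ≫ g') := by
  obtain ⟨γ⟩ := hf
  obtain ⟨δ⟩ := hg
  have := isGeneratedBy_unitInterval T
  exact ⟨⟨⟨fun x => γ x ≫ δ x,
    continuous_comp_of_isGeneratedBy T γ.continuous δ.continuous⟩, by simp, by simp⟩⟩

variable {ι : Type t} (T : ι → Type s) [∀ i, TopologicalSpace (T i)]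
  (C : Type u) [Category.{v} C] [∀ A B : C, TopologicalSpace (A ⟶ B)] [SpaceEnriched T C]

/-- The mapping space functor, `(A, B) ↦ Map(A, B)`. -/
@[simps]
def mapSpace : Cᵒᵖ ⥤ C ⥤ TopCat.{v} where
  obj A :=
    { obj := fun B => TopCat.of (A.unop ⟶ B)
      map := fun f => TopCat.ofHom ⟨fun g => g ≫ f, continuous_postcomp T A.unop f⟩ }
  map f :=
    { app := fun B => TopCat.ofHom ⟨fun g => f.unop ≫ g, continuous_precomp T f.unop B⟩ }

/-- The objects of the homotopy category of `C`. -/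
structure HoCat {ι : Type t} (T : ι → Type s) (C : Type u) where
  of ::
  as : C

/-- The homotopy category: morphisms are path components of mapping spaces. -/
instance [ConvenientFamily T] : Category.{v} (HoCat T C) where
  Hom A B := ZerothHomotopy (A.as ⟶ B.as)
  id A := ZerothHomotopy.mk (𝟙 A.as)
  comp := Quotient.map₂ (fun f g => f ≫ g) fun _ _ hf _ _ hg => joined_comp T hf hg
  id_comp f := by
    induction f using Quotient.inductionOn with | _ f => ?_
    exact congrArg ZerothHomotopy.mk (Category.id_comp f)
  comp_id f := by
    induction f using Quotient.inductionOn with | _ f => ?_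
    exact congrArg ZerothHomotopy.mk (Category.comp_id f)
  assoc f g h := by
    induction f using Quotient.inductionOn with | _ f => ?_
    induction g using Quotient.inductionOn with | _ g => ?_
    induction h using Quotient.inductionOn with | _ h => ?_
    exact congrArg ZerothHomotopy.mk (Category.assoc f g h)

/-- The projection functor to the homotopy category. -/
def toHoCat [ConvenientFamily T] : C ⥤ HoCat T C where
  obj A := ⟨A⟩
  map f := ZerothHomotopy.mk f

end Enriched

/-! ### Homotopy limits of spaces -/

section HoLimSpaces

variable {J : Type w} [Category.{w'} J]

/-- The homotopy limit of a diagram of spaces: the totalization of the cosimplicial space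
`[n] ↦ ∏_{j₀ → ⋯ → jₙ} F(jₙ)`. A point is a family of maps `Δⁿ → F(jₙ)`, indexed by the chains
`j₀ → ⋯ → jₙ` of all lengths `n`, that is compatible with all monotone maps `[m] → [n]`. -/
def HoLim (F : J ⥤ TopCat.{v}) : Type (max w w' v) :=
  { x : ∀ (n : ℕ) (σ : ComposableArrows J n),
      C(stdSimplex ℝ (Fin (n + 1)), F.obj (σ.obj (Fin.last n))) //
    ∀ (m n : ℕ) (θ : Fin (m + 1) →o Fin (n + 1)) (σ : ComposableArrows J n)
      (p : stdSimplex ℝ (Fin (m + 1))),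
      F.map (σ.map (homOfLE (Fin.le_last (θ (Fin.last m)))))
        (x m (θ.monotone.functor ⋙ σ) p) = x n σ (stdSimplex.map θ p) }

/-- The subspace topology from the product of the spaces of maps `Δⁿ → F(jₙ)`, with their
compact-open topologies. Passing to the associated `T`-generated topology would not change the
continuous maps from cubes, hence neither the homotopy groups. -/
instance (F : J ⥤ TopCat.{v}) : TopologicalSpace (HoLim F) :=
  inferInstanceAs (TopologicalSpace (Subtype _))

/-- The map of homotopy limits induced by a natural transformation. -/
def HoLim.map {F G : J ⥤ TopCat.{v}} (α : F ⟶ G) (x : HoLim F) : HoLim G :=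
  ⟨fun n σ => (α.app (σ.obj (Fin.last n))).hom.comp (x.1 n σ), fun m n θ σ p => by
    have h := congrArg (α.app (σ.obj (Fin.last n))) (x.2 m n θ σ p)
    have h' := ConcreteCategory.congr_hom
      (α.naturality (σ.map (homOfLE (Fin.le_last (θ (Fin.last m))))))
      (x.1 m (θ.monotone.functor ⋙ σ) p)
    exact h'.symm.trans h⟩

/-- The value of a point of the homotopy limit at an object `j` of the diagram. -/
def HoLim.proj {F : J ⥤ TopCat.{v}} (x : HoLim F) (j : J) : F.obj j :=
  x.1 0 (ComposableArrows.mk₀ j) (stdSimplex.vertex 0)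

end HoLimSpaces

/-! ### Homotopy limits and colimits in an enriched category -/

section HoLimEnriched

variable {ι : Type t} (T : ι → Type s) [∀ i, TopologicalSpace (T i)]
  {C : Type u} [Category.{v} C] [∀ A B : C, TopologicalSpace (A ⟶ B)] [SpaceEnriched T C]
  {J : Type w} [Category.{w'} J]

/-- The homotopy limit `holim_J Map(X, Y_j)`; a point is a homotopy coherent cone from `X` to `Y`. -/
abbrev HoCone (Y : J ⥤ C) (X : C) := HoLim (Y ⋙ (mapSpace T C).obj (op X))

/-- The homotopy limit `holim_{Jᵒᵖ} Map(X_j, Y)`; a point is a homotopy coherent cocone from `X`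
to `Y`. -/
abbrev HoCocone (X : J ⥤ C) (Y : C) := HoLim (X.op ⋙ (mapSpace T C).flip.obj Y)

variable {T}

/-- The natural map `Map(X, L) → holim_J Map(X, Y_j)` given by a cone from `L` to `Y`. -/
def HoCone.precomp {Y : J ⥤ C} {L : C} (c : HoCone T Y L) (X : C) (g : X ⟶ L) : HoCone T Y X :=
  HoLim.map (Functor.whiskerLeft Y ((mapSpace T C).map g.op)) c

/-- The natural map `Map(L, Y) → holim_{Jᵒᵖ} Map(X_j, Y)` given by a cocone from `X` to `L`. -/
def HoCocone.postcomp {X : J ⥤ C} {L : C} (c : HoCocone T X L) (Y : C) (g : L ⟶ Y) :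
    HoCocone T X Y :=
  HoLim.map (Functor.whiskerLeft X.op ((mapSpace T C).flip.map g)) c

/-- `L` is a homotopy limit of `Y`, by means of the cone `c`: the natural map
`Map(X, L) → holim_J Map(X, Y_j)` is a weak equivalence for all `X`. -/
def IsHoLim {Y : J ⥤ C} {L : C} (c : HoCone T Y L) : Prop :=
  ∀ X : C, IsWeakEquiv (c.precomp X)

/-- `L` is a homotopy colimit of `X`, by means of the cocone `c`: the natural map
`Map(L, Y) → holim_{Jᵒᵖ} Map(X_j, Y)` is a weak equivalence for all `Y`. -/
def IsHoColim {X : J ⥤ C} {L : C} (c : HoCocone T X L) : Prop :=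
  ∀ Y : C, IsWeakEquiv (c.postcomp Y)

/-- The leg `X_j → L` of a cocone. -/
def HoCocone.leg {X : J ⥤ C} {L : C} (c : HoCocone T X L) (j : J) : X.obj j ⟶ L :=
  HoLim.proj c (op j)

/-- Restriction of a cocone along a map of diagrams. -/
def HoCocone.restrict {A B : J ⥤ C} (α : A ⟶ B) {L : C} (c : HoCocone T B L) : HoCocone T A L :=
  HoLim.map (Functor.whiskerRight (NatTrans.op α) ((mapSpace T C).flip.obj L)) c

/-- `f : hocolim A → hocolim B` is (a representative of) the map induced by `α : A ⟶ B`: the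
two cocones from `A` to `hocolim B` given by `f` and by `α` lie in the same path component of the
space of cocones. -/
def IsInducedMap {A B : J ⥤ C} (α : A ⟶ B) {LA LB : C} (a : HoCocone T A LA)
    (b : HoCocone T B LB) (f : LA ⟶ LB) : Prop :=
  Joined (a.postcomp LB f) (b.restrict α)

variable (T) in
/-- A square with sides `f : A ⟶ B`, `g : A ⟶ A'`, `f' : A' ⟶ B'`, `g' : B ⟶ B'` is a homotopy
pushout if `f'` and `g'` are legs of a (homotopy coherent) cocone that makes `B'` a homotopy colimit
of the span `A' ⟵ A ⟶ B`. The homotopies that fill the square are part of the cocone. -/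
def IsHoPushout {A B A' B' : C} (f : A ⟶ B) (g : A ⟶ A') (f' : A' ⟶ B') (g' : B ⟶ B') : Prop :=
  ∃ c : HoCocone T (span g f) B',
    IsHoColim c ∧ c.leg WalkingSpan.left = f' ∧ c.leg WalkingSpan.right = g'

end HoLimEnriched

/-! ### Local objects and local equivalences -/

section Localization

variable {C : Type u} [Category.{v} C] [∀ A B : C, TopologicalSpace (A ⟶ B)]

/-- `Y` is `S`-local if `f^* : Map(B, Y) → Map(A, Y)` is a weak equivalence for all `f : A ⟶ B`
in `S`. -/
def IsLocal (S : MorphismProperty C) (Y : C) : Prop :=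
  ∀ ⦃A B : C⦄ (f : A ⟶ B), S f → IsWeakEquiv fun g : B ⟶ Y => f ≫ g

/-- `f : A ⟶ B` is an `S`-equivalence if `f^* : Map(B, Y) → Map(A, Y)` is a weak equivalence
for all `S`-local `Y`. -/
def IsLocalEquiv (S : MorphismProperty C) {A B : C} (f : A ⟶ B) : Prop :=
  ∀ Y : C, IsLocal S Y → IsWeakEquiv fun g : B ⟶ Y => f ≫ g

end Localization

end SpaceLocalization

end

open SpaceLocalization

noncomputable section

namespace SpaceLocalization

open unitInterval

/-! ### Cells -/

/-! All six statements concern the maps `f^*` between mapping spaces, so they follow from four facts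
about weak equivalences: two-out-of-three, invariance under homotopy, preservation by homotopy
limits (`isWeakEquiv_hoLimMap`), and the fact that the homotopy limit of a cospan with one leg a
weak equivalence projects by a weak equivalence to the source of the other leg
(`isWeakEquiv_proj_of_cospan`).

The tool for the last two is the base-point-free criterion `RelLift`: a map is a weak equivalence
exactly when every square from the boundary inclusion of a cell has a lift that is strict on the
boundary and correct up to relative homotopy on the cell (`IsWeakEquiv.relLift`,
`RelLift.isWeakEquiv`). It rests on the homotopy extension property, which allows a map on a cell to
be transported along a homotopy of its boundary values.

For homotopy limits, a map of diagrams is replaced by the evaluation of its mapping path spaces,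
which lifts strictly against cells. A lift into the totalization is then built by induction on the
length of chains. On degenerate chains the values are forced (Eilenberg-Zilber); on a nondegenerate
`k`-chain they are prescribed on the boundary of `K × Δᵏ`, which is again a cell, and the strict
lifting property fills it.

Local objects under homotopy limits and local equivalences under homotopy colimits then follow from
the squares comparing `Map` with `holim Map`. For homotopy colimits the square commutes only up to a
path of cocones. Since enriched composition is continuous only on `T`-generated spaces, the
resulting homotopies are known to be continuous only along cells, which is all that
`IsWeakEquiv.of_homotopy` requires. -/

/-- A continuous map out of a compact space descends along a surjection onto a Hausdorff space. -/
theorem exists_descend {A : Type*} {B : Type*} {X : Type*} [TopologicalSpace A]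
    [TopologicalSpace B] [TopologicalSpace X] [CompactSpace A] [T2Space B] (q : C(A, B))
    (hq : Function.Surjective q) (g : C(A, X)) (h : ∀ a a', q a = q a' → g a = g a') :
    ∃ g' : C(B, X), ∀ a, g' (q a) = g a := by
  have hQ : IsQuotientMap q := q.continuous.isClosedMap.isQuotientMap q.continuous hq
  refine ⟨hQ.lift g h, fun a => ?_⟩
  exact congrArg (fun k : C(A, X) => k a) (hQ.lift_comp g h)

/-- The boundary of a product of two pairs. -/
def prodBd {K K' : Type*} (L : Set K) (M : Set K') : Set (K × K') :=
  {p | p.1 ∈ L ∨ p.2 ∈ M}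

/-- The pair `(K, L)` is homeomorphic to the `n`-cube and its boundary. -/
def IsCell (n : ℕ) (K : Type) [TopologicalSpace K] (L : Set K) : Prop :=
  ∃ e : K ≃ₜ (Fin n → I), ∀ x, x ∈ L ↔ e x ∈ Cube.boundary (Fin n)

theorem isCell_cube (n : ℕ) : IsCell n (Fin n → I) (Cube.boundary (Fin n)) :=
  ⟨Homeomorph.refl _, fun _ => Iff.rfl⟩

theorem isCell_unitInterval : IsCell 1 I {0, 1} :=
  ⟨(Homeomorph.funUnique (Fin 1) I).symm, fun x => by
    simp [Cube.boundary]⟩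

theorem IsCell.prod {m n : ℕ} {K K' : Type} [TopologicalSpace K] [TopologicalSpace K']
    {L : Set K} {L' : Set K'} (h : IsCell m K L) (h' : IsCell n K' L') :
    IsCell (m + n) (K × K') (prodBd L L') := by
  obtain ⟨e, he⟩ := h
  obtain ⟨e', he'⟩ := h'
  refine ⟨((e.prodCongr e').trans Homeomorph.sumArrowHomeomorphProdArrow.symm).trans
    (Homeomorph.piCongrLeft (Y := fun _ => I) finSumFinEquiv), fun x => ?_⟩
  have key : ∀ (y : Fin m ⊕ Fin n → I),
      Homeomorph.piCongrLeft (Y := fun _ => I) finSumFinEquiv y ∈ Cube.boundary (Fin (m + n)) ↔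
        ∃ i, y i = 0 ∨ y i = 1 := by
    intro y
    have ev : ∀ j, Homeomorph.piCongrLeft (Y := fun _ => I) finSumFinEquiv y
        (finSumFinEquiv j) = y j := fun j =>
      Equiv.piCongrLeft_apply_apply (fun _ => I) finSumFinEquiv y j
    constructor
    · rintro ⟨i, hi⟩
      obtain ⟨j, rfl⟩ := finSumFinEquiv.surjective i
      refine ⟨j, ?_⟩
      rwa [ev] at hi
    · rintro ⟨i, hi⟩
      refine ⟨finSumFinEquiv i, ?_⟩
      rwa [ev]
  simp only [Homeomorph.trans_apply]
  rw [key]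
  simp only [prodBd, Set.mem_ofPred_eq, he, he', Cube.boundary, Sum.exists]
  rfl

section CellProperties

variable {n : ℕ} {K : Type} [TopologicalSpace K] {L : Set K}

theorem IsCell.compactSpace (h : IsCell n K L) : CompactSpace K := by
  obtain ⟨e, -⟩ := h
  exact e.symm.compactSpace

theorem IsCell.t2Space (h : IsCell n K L) : T2Space K := by
  obtain ⟨e, -⟩ := h
  exact e.symm.t2Space

theorem isClosed_cubeBoundary (n : ℕ) : IsClosed (Cube.boundary (Fin n)) := by
  have : Cube.boundary (Fin n) = ⋃ i : Fin n, {y | y i = 0} ∪ {y | y i = 1} := by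
    ext y; simp [Cube.boundary]
  rw [this]
  refine isClosed_iUnion_of_finite fun i => ?_
  exact (isClosed_eq (continuous_apply i) continuous_const).union
    (isClosed_eq (continuous_apply i) continuous_const)

theorem IsCell.isClosed (h : IsCell n K L) : IsClosed L := by
  obtain ⟨e, he⟩ := h
  have : L = e ⁻¹' Cube.boundary (Fin n) := Set.ext he
  rw [this]
  exact (isClosed_cubeBoundary n).preimage e.continuous

theorem IsCell.compactSpace_bd (h : IsCell n K L) : CompactSpace L :=
  have := h.compactSpace
  isCompact_iff_compactSpace.mp h.isClosed.isCompact

/-- Cells are the parameter spaces over which composition in an enriched category will be known to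
be continuous. -/
theorem IsCell.isGeneratedBy (h : IsCell n K L) {ι : Type t} (T : ι → Type s)
    [∀ i, TopologicalSpace (T i)] [ConvenientFamily T] : IsGeneratedBy T K := by
  obtain ⟨e, -⟩ := h
  have := ConvenientFamily.cube (T := T) n
  exact e.symm.isQuotientMap.isGeneratedBy

end CellProperties

/-! ### The homotopy extension property -/

/-- The homotopy extension property of the unit ball and its sphere. -/
theorem exists_homotopy_extension_ball {E : Type*} [NormedAddCommGroup E] [NormedSpace ℝ E]
    [ProperSpace E] {X : Type*} [TopologicalSpace X] (a : C(Metric.closedBall (0 : E) 1, X))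
    (Γ : C(I × Metric.sphere (0 : E) 1, X))
    (h : ∀ x : Metric.sphere (0 : E) 1,
      Γ (0, x) = a ⟨x, Metric.sphere_subset_closedBall x.2⟩) :
    ∃ H : C(I × Metric.closedBall (0 : E) 1, X), (∀ x, H (0, x) = a x) ∧
      ∀ t (x : Metric.sphere (0 : E) 1),
        H (t, ⟨x, Metric.sphere_subset_closedBall x.2⟩) = Γ (t, x) := by
  let B := Metric.closedBall (0 : E) 1
  -- The extension is composition with the projection of the cylinder onto its bottom and side from
  -- the point at height `2` above the centre. The ray through `(t, x)` meets the bottom in `x / (1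
  -- - t/2)` if `‖x‖ ≤ 1 - t/2`, and otherwise the side, at height `2 - (2 - t) / ‖x‖`.
  let A₁ : Set (I × B) := {p | ‖(p.2 : E)‖ ≤ 1 - (p.1 : ℝ) / 2}
  let A₂ : Set (I × B) := {p | 1 - (p.1 : ℝ) / 2 ≤ ‖(p.2 : E)‖}
  have hA₁ : IsClosed A₁ := isClosed_le (by fun_prop) (by fun_prop)
  have hA₂ : IsClosed A₂ := isClosed_le (by fun_prop) (by fun_prop)
  have : CompactSpace A₁ := isCompact_iff_compactSpace.mp hA₁.isCompact
  have : CompactSpace A₂ := isCompact_iff_compactSpace.mp hA₂.isCompact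
  have pos : ∀ p : I, (0 : ℝ) < 1 - (p : ℝ) / 2 := fun p => by linarith [p.2.2]
  have pos₂ : ∀ p : A₂, (0 : ℝ) < ‖(p.1.2 : E)‖ := fun p => (pos p.1.1).trans_le p.2
  have le₂ : ∀ p : A₂, ‖(p.1.2 : E)‖ ≤ 1 := fun p => mem_closedBall_zero_iff.1 p.1.2.2
  let r₁ : C(A₁, B) := ⟨fun p => ⟨(1 - (p.1.1 : ℝ) / 2)⁻¹ • (p.1.2 : E), by
      rw [mem_closedBall_zero_iff, norm_smul, norm_inv, Real.norm_of_nonneg (pos _).le,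
        inv_mul_le_one₀ (pos _)]
      exact p.2⟩, by
      refine Continuous.subtype_mk (Continuous.smul (Continuous.inv₀ (by fun_prop) ?_)
        (by fun_prop)) _
      exact fun p => (pos _).ne'⟩
  let s₂ : C(A₂, Metric.sphere (0 : E) 1) := ⟨fun p => ⟨‖(p.1.2 : E)‖⁻¹ • (p.1.2 : E), by
      rw [mem_sphere_zero_iff_norm, norm_smul, norm_inv, norm_norm,
        inv_mul_cancel₀ (pos₂ p).ne']⟩, by
      refine Continuous.subtype_mk (Continuous.smul (Continuous.inv₀ (by fun_prop) ?_)
        (by fun_prop)) _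
      exact fun p => (pos₂ p).ne'⟩
  let t₂ : C(A₂, I) := ⟨fun p => ⟨2 - (2 - (p.1.1 : ℝ)) / ‖(p.1.2 : E)‖, by
      have h1 := pos₂ p
      have h2 := le₂ p
      have h3 : 1 - (p.1.1 : ℝ) / 2 ≤ ‖(p.1.2 : E)‖ := p.2
      have h4 := p.1.1.2.2
      constructor
      · rw [sub_nonneg, div_le_iff₀ h1]; linarith
      · rw [sub_le_comm, le_div_iff₀ h1]; linarith⟩, by
      refine Continuous.subtype_mk (continuous_const.sub (Continuous.div (by fun_prop)
        (by fun_prop) ?_)) _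
      exact fun p => (pos₂ p).ne'⟩
  let q : C(A₁ ⊕ A₂, I × B) := ⟨Sum.elim Subtype.val Subtype.val, by fun_prop⟩
  let g : C(A₁ ⊕ A₂, X) := ⟨Sum.elim (fun p => a (r₁ p)) (fun p => Γ (t₂ p, s₂ p)), by fun_prop⟩
  have agree : ∀ (p : A₁) (p' : A₂), p.1 = p'.1 → a (r₁ p) = Γ (t₂ p', s₂ p') := by
    rintro ⟨p, hp⟩ ⟨p', hp'⟩ (rfl : p = p')
    have e : ‖(p.2 : E)‖ = 1 - (p.1 : ℝ) / 2 := le_antisymm hp hp'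
    have e1 : t₂ ⟨p, hp'⟩ = 0 := by
      apply Subtype.ext
      change 2 - (2 - (p.1 : ℝ)) / ‖(p.2 : E)‖ = 0
      rw [e]
      have := (pos p.1).ne'
      rw [sub_eq_zero, eq_div_iff this]; ring
    rw [e1, h]
    congr 1
    apply Subtype.ext
    change (1 - (p.1 : ℝ) / 2)⁻¹ • (p.2 : E) = ‖(p.2 : E)‖⁻¹ • (p.2 : E)
    rw [e]
  obtain ⟨H, hH⟩ := exists_descend q (by
    intro p
    rcases le_total ‖(p.2 : E)‖ (1 - (p.1 : ℝ) / 2) with hp | hp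
    · exact ⟨Sum.inl ⟨p, hp⟩, rfl⟩
    · exact ⟨Sum.inr ⟨p, hp⟩, rfl⟩) g (by
    rintro (p | p) (p' | p') hpp
    · exact congrArg (fun z => a (r₁ z)) (Subtype.ext hpp)
    · exact agree p p' hpp
    · exact (agree p' p hpp.symm).symm
    · exact congrArg (fun z => Γ (t₂ z, s₂ z)) (Subtype.ext hpp))
  refine ⟨H, fun x => ?_, fun t x => ?_⟩
  · have hx : ((0 : I), x) ∈ A₁ := by
      change ‖(x : E)‖ ≤ 1 - ((0 : I) : ℝ) / 2
      simpa using mem_closedBall_zero_iff.1 x.2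
    refine (hH (Sum.inl ⟨_, hx⟩)).trans ?_
    change a (r₁ _) = a x
    congr 1
    apply Subtype.ext
    change (1 - ((0 : I) : ℝ) / 2)⁻¹ • (x : E) = x
    simp
  · have nx : ‖(x : E)‖ = 1 := mem_sphere_zero_iff_norm.1 x.2
    have hx : (t, (⟨x, Metric.sphere_subset_closedBall x.2⟩ : B)) ∈ A₂ := by
      change 1 - (t : ℝ) / 2 ≤ ‖(x : E)‖
      rw [nx]; linarith [t.2.1]
    refine (hH (Sum.inr ⟨_, hx⟩)).trans ?_
    change Γ (t₂ _, s₂ _) = _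
    congr 2
    · apply Subtype.ext
      change 2 - (2 - (t : ℝ)) / ‖(x : E)‖ = t
      rw [nx]; ring
    · apply Subtype.ext
      change ‖(x : E)‖⁻¹ • (x : E) = x
      rw [nx]; simp

/-- The cube as the closed unit ball for the supremum norm. -/
def cubeHomeoBall (n : ℕ) : (Fin n → I) ≃ₜ Metric.closedBall (0 : Fin n → ℝ) 1 where
  toFun x := ⟨fun i => 2 * (x i : ℝ) - 1, by
    rw [mem_closedBall_zero_iff, pi_norm_le_iff_of_nonneg zero_le_one]
    intro i
    rw [Real.norm_eq_abs, abs_le]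
    constructor <;> linarith [(x i).2.1, (x i).2.2]⟩
  invFun y := fun i => ⟨((y : Fin n → ℝ) i + 1) / 2, by
    have h := (pi_norm_le_iff_of_nonneg zero_le_one).1 (mem_closedBall_zero_iff.1 y.2) i
    rw [Real.norm_eq_abs, abs_le] at h
    constructor <;> linarith⟩
  left_inv x := by ext i; simp
  right_inv y := by ext i; simp; ring
  continuous_toFun := by fun_prop
  continuous_invFun := continuous_pi fun i => Continuous.subtype_mk
    ((((continuous_apply i).comp continuous_subtype_val).add continuous_const).div_const 2) _

theorem norm_cubeHomeoBall_eq_one_iff (n : ℕ) (x : Fin n → I) :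
    ‖(cubeHomeoBall n x : Fin n → ℝ)‖ = 1 ↔ x ∈ Cube.boundary (Fin n) := by
  have hle : ‖(cubeHomeoBall n x : Fin n → ℝ)‖ ≤ 1 :=
    mem_closedBall_zero_iff.1 (cubeHomeoBall n x).2
  constructor
  · intro h
    by_contra hx
    have : ‖(cubeHomeoBall n x : Fin n → ℝ)‖ < 1 := by
      rw [pi_norm_lt_iff zero_lt_one]
      intro i
      have h0 : x i ≠ 0 := fun h => hx ⟨i, Or.inl h⟩
      have h1 : x i ≠ 1 := fun h => hx ⟨i, Or.inr h⟩
      have h0' := unitInterval.pos_iff_ne_zero.2 h0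
      have h1' := unitInterval.lt_one_iff_ne_one.2 h1
      change ‖2 * (x i : ℝ) - 1‖ < 1
      have h0'' : (0 : ℝ) < x i := h0'
      have h1'' : (x i : ℝ) < 1 := h1'
      rw [Real.norm_eq_abs, abs_lt]
      constructor <;> linarith
    exact this.ne h
  · rintro ⟨i, hi⟩
    refine le_antisymm hle (le_trans ?_ (norm_le_pi_norm _ i))
    change 1 ≤ ‖2 * (x i : ℝ) - 1‖
    rcases hi with hi | hi <;> rw [hi] <;> norm_num

/-- The homotopy extension property of a cell and its boundary. -/
theorem IsCell.exists_homotopy_extension {n : ℕ} {K : Type} [TopologicalSpace K] {L : Set K}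
    (hK : IsCell n K L) {X : Type*} [TopologicalSpace X] (a : C(K, X)) (Γ : C(I × L, X))
    (h : ∀ x : L, Γ (0, x) = a x) :
    ∃ H : C(I × K, X), (∀ x, H (0, x) = a x) ∧ ∀ t (x : L), H (t, (x : K)) = Γ (t, x) := by
  obtain ⟨e, he⟩ := hK
  let e' := e.trans (cubeHomeoBall n)
  have he' : ∀ x, x ∈ L ↔ ‖(e' x : Fin n → ℝ)‖ = 1 := fun x =>
    (he x).trans (norm_cubeHomeoBall_eq_one_iff n _).symm
  let k : C(Metric.sphere (0 : Fin n → ℝ) 1, L) :=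
    ⟨fun y => ⟨e'.symm ⟨y, Metric.sphere_subset_closedBall y.2⟩, by
      rw [he', e'.apply_symm_apply]; exact mem_sphere_zero_iff_norm.1 y.2⟩, by fun_prop⟩
  obtain ⟨H, h0, h1⟩ := exists_homotopy_extension_ball (a.comp ⟨e'.symm, e'.symm.continuous⟩)
    (Γ.comp ((ContinuousMap.id I).prodMap k)) (fun x => h _)
  refine ⟨H.comp ((ContinuousMap.id I).prodMap ⟨e', e'.continuous⟩), fun x => ?_, fun t x => ?_⟩
  · exact (h0 (e' x)).trans (congrArg a (e'.symm_apply_apply x))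
  · refine (h1 t ⟨e' x, mem_sphere_zero_iff_norm.2 ((he' x).1 x.2)⟩).trans ?_
    change Γ (t, k _) = _
    congr 2
    exact Subtype.ext (e'.symm_apply_apply x)

end SpaceLocalization

namespace SpaceLocalization

open unitInterval

/-! ### Free homotopies with prescribed boundary values -/

theorem prodBd_induction {K : Type} {L : Set K} {p : prodBd ({0, 1} : Set I) L → Prop}
    (h0 : ∀ x, p ⟨(0, x), Or.inl (Or.inl rfl)⟩) (h1 : ∀ x, p ⟨(1, x), Or.inl (Or.inr rfl)⟩)
    (h2 : ∀ s (l : L), p ⟨(s, l), Or.inr l.2⟩) (y : prodBd ({0, 1} : Set I) L) : p y := by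
  obtain ⟨⟨s, x⟩, h⟩ := y
  have h' := h
  obtain (h' : s = 0 ∨ s = 1) | (h' : x ∈ L) := h'
  · rcases h' with rfl | rfl
    · exact h0 x
    · exact h1 x
  · exact h2 s ⟨x, h'⟩

section Transport

variable {K : Type} [TopologicalSpace K] {L : Set K} {X : Type u} [TopologicalSpace X]
  {Y : Type v} [TopologicalSpace Y]

/-- There is a homotopy from `a` to `b` whose restriction to `L` is `Γ`. -/
def Transp (Γ : C(I × L, X)) (a b : C(K, X)) : Prop :=
  ∃ H : C(I × K, X), (∀ x, H (0, x) = a x) ∧ (∀ x, H (1, x) = b x) ∧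
    ∀ t (x : L), H (t, (x : K)) = Γ (t, x)

theorem homotopicRel_iff {a b : C(K, X)} : a.HomotopicRel b L ↔
    ∃ H : C(I × K, X), (∀ x, H (0, x) = a x) ∧ (∀ x, H (1, x) = b x) ∧
      ∀ t, ∀ x ∈ L, H (t, x) = a x := by
  constructor
  · rintro ⟨H⟩
    exact ⟨H.toContinuousMap, H.apply_zero, H.apply_one, fun t x hx => H.eq_fst t hx⟩
  · rintro ⟨H, h0, h1, h2⟩
    exact ⟨⟨⟨H, h0, h1⟩, h2⟩⟩

/-- The homotopy `Γ`, run backwards. -/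
def revHtpy (Γ : C(I × L, X)) : C(I × L, X) :=
  Γ.comp ((⟨σ, continuous_symm⟩ : C(I, I)).prodMap (ContinuousMap.id L))

@[simp]
theorem revHtpy_apply (Γ : C(I × L, X)) (t : I) (x : L) : revHtpy Γ (t, x) = Γ (σ t, x) := rfl

theorem Transp.symm {Γ : C(I × L, X)} {a b : C(K, X)} (h : Transp Γ a b) :
    Transp (revHtpy Γ) b a := by
  obtain ⟨H, h0, h1, h2⟩ := h
  refine ⟨H.comp ((⟨σ, continuous_symm⟩ : C(I, I)).prodMap (ContinuousMap.id K)), fun x => ?_,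
    fun x => ?_, fun t x => h2 _ _⟩
  · exact (congrArg (fun s => H (s, x)) symm_zero).trans (h1 x)
  · exact (congrArg (fun s => H (s, x)) symm_one).trans (h0 x)

theorem revHtpy_revHtpy (Γ : C(I × L, X)) : revHtpy (revHtpy Γ) = Γ := by
  ext ⟨t, x⟩; simp

theorem Transp.map (f : C(X, Y)) {Γ : C(I × L, X)} {a b : C(K, X)} (h : Transp Γ a b) :
    Transp (f.comp Γ) (f.comp a) (f.comp b) := by
  obtain ⟨H, h0, h1, h2⟩ := h
  exact ⟨f.comp H, fun x => congrArg f (h0 x), fun x => congrArg f (h1 x),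
    fun t x => congrArg f (h2 t x)⟩

theorem Transp.apply_zero {Γ : C(I × L, X)} {a b : C(K, X)} (h : Transp Γ a b) (x : L) :
    a x = Γ (0, x) := by
  obtain ⟨H, h0, h1, h2⟩ := h
  rw [← h0, h2]

theorem Transp.apply_one {Γ : C(I × L, X)} {a b : C(K, X)} (h : Transp Γ a b) (x : L) :
    b x = Γ (1, x) := by
  obtain ⟨H, h0, h1, h2⟩ := h
  rw [← h1, h2]

/-- Gluing a family of maps on the boundary of `I × K`, parametrized by `Z`. -/
theorem exists_glue_cylinder {Z : Type} [TopologicalSpace Z] [CompactSpace Z] [T2Space Z]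
    [CompactSpace K] [T2Space K] [CompactSpace L] (P₀ P₁ : C(Z × K, X)) (Q : C(Z × (I × L), X))
    (h0 : ∀ z (l : L), Q (z, (0, l)) = P₀ (z, (l : K)))
    (h1 : ∀ z (l : L), Q (z, (1, l)) = P₁ (z, (l : K))) :
    ∃ G : C(Z × prodBd ({0, 1} : Set I) L, X),
      (∀ z x, G (z, ⟨(0, x), Or.inl (Or.inl rfl)⟩) = P₀ (z, x)) ∧
      (∀ z x, G (z, ⟨(1, x), Or.inl (Or.inr rfl)⟩) = P₁ (z, x)) ∧
      ∀ z s (l : L), G (z, ⟨(s, l), Or.inr l.2⟩) = Q (z, (s, l)) := by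
  let q : C((Z × K ⊕ Z × K) ⊕ Z × (I × L), Z × prodBd ({0, 1} : Set I) L) :=
    ⟨Sum.elim (Sum.elim (fun p => (p.1, ⟨(0, p.2), Or.inl (Or.inl rfl)⟩))
      (fun p => (p.1, ⟨(1, p.2), Or.inl (Or.inr rfl)⟩)))
      (fun p => (p.1, ⟨(p.2.1, p.2.2), Or.inr p.2.2.2⟩)), by fun_prop⟩
  let g : C((Z × K ⊕ Z × K) ⊕ Z × (I × L), X) := ⟨Sum.elim (Sum.elim P₀ P₁) Q, by fun_prop⟩
  have hq : Function.Surjective q := by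
    rintro ⟨z, y⟩
    induction y using prodBd_induction with
    | h0 x => exact ⟨Sum.inl (Sum.inl (z, x)), rfl⟩
    | h1 x => exact ⟨Sum.inl (Sum.inr (z, x)), rfl⟩
    | h2 s l => exact ⟨Sum.inr (z, (s, l)), rfl⟩
  obtain ⟨G, hG⟩ := exists_descend q hq g (by
    rintro ((⟨z, x⟩ | ⟨z, x⟩) | ⟨z, s, ⟨x, hx⟩⟩) ((⟨z', x'⟩ | ⟨z', x'⟩) | ⟨z', s', ⟨x', hx'⟩⟩) h <;>
    replace h := (⟨congrArg Prod.fst h, Prod.mk.inj (congrArg (fun p => (p.2 : I × K)) h)⟩ :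
      z = z' ∧ _ = _ ∧ x = x')
    · obtain ⟨rfl, -, rfl⟩ := h; rfl
    · exact (zero_ne_one h.2.1).elim
    · obtain ⟨rfl, rfl, rfl⟩ := h; exact (h0 _ ⟨x, hx'⟩).symm
    · exact (one_ne_zero h.2.1).elim
    · obtain ⟨rfl, -, rfl⟩ := h; rfl
    · obtain ⟨rfl, rfl, rfl⟩ := h; exact (h1 _ ⟨x, hx'⟩).symm
    · obtain ⟨rfl, rfl, rfl⟩ := h; exact h0 _ ⟨x, hx⟩
    · obtain ⟨rfl, rfl, rfl⟩ := h; exact h1 _ ⟨x, hx⟩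
    · obtain ⟨rfl, rfl, rfl⟩ := h; rfl)
  exact ⟨G, fun z x => hG (Sum.inl (Sum.inl (z, x))), fun z x => hG (Sum.inl (Sum.inr (z, x))),
    fun z s l => hG (Sum.inr (z, (s, l)))⟩

variable {n : ℕ}

theorem IsCell.exists_transp (hK : IsCell n K L) (a : C(K, X)) (Γ : C(I × L, X))
    (h : ∀ x : L, Γ (0, x) = a x) : ∃ b : C(K, X), Transp Γ a b := by
  obtain ⟨H, h0, h1⟩ := hK.exists_homotopy_extension a Γ h
  exact ⟨H.comp ⟨fun x => (1, x), by fun_prop⟩, H, h0, fun _ => rfl, h1⟩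

/-- A map on the cylinder over a cell can be deformed along a homotopy of its restriction to the
boundary of the cylinder. -/
theorem IsCell.exists_prism (hK : IsCell n K L) (M P₀ P₁ : C(I × K, X)) (Q : C(I × (I × L), X))
    (hP₀ : ∀ x, P₀ (0, x) = M (0, x)) (hP₁ : ∀ x, P₁ (0, x) = M (1, x))
    (hQ : ∀ s (l : L), Q (0, (s, l)) = M (s, (l : K)))
    (hQ₀ : ∀ t (l : L), Q (t, (0, l)) = P₀ (t, (l : K)))
    (hQ₁ : ∀ t (l : L), Q (t, (1, l)) = P₁ (t, (l : K))) :
    ∃ N : C(I × K, X), (∀ x, N (0, x) = P₀ (1, x)) ∧ (∀ x, N (1, x) = P₁ (1, x)) ∧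
      ∀ s (l : L), N (s, (l : K)) = Q (1, (s, l)) := by
  have := hK.compactSpace
  have := hK.t2Space
  have := hK.compactSpace_bd
  obtain ⟨G, g0, g1, g2⟩ := exists_glue_cylinder P₀ P₁ Q hQ₀ hQ₁
  -- Homotopy extension for the cell `I × K`: `M` is deformed, with `P₀`, `P₁` and `Q` prescribed on
  -- the two ends and the side. The result is the slice at time `1`.
  obtain ⟨H, h0, h1⟩ := (isCell_unitInterval.prod hK).exists_homotopy_extension M G (by
    intro y
    induction y using prodBd_induction with
    | h0 x => exact (g0 _ _).trans (hP₀ x)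
    | h1 x => exact (g1 _ _).trans (hP₁ x)
    | h2 s l => exact (g2 _ s l).trans (hQ s l))
  exact ⟨H.comp ⟨fun x => (1, x), by fun_prop⟩,
    fun x => (h1 1 ⟨(0, x), Or.inl (Or.inl rfl)⟩).trans (g0 1 x),
    fun x => (h1 1 ⟨(1, x), Or.inl (Or.inr rfl)⟩).trans (g1 1 x),
    fun s l => (h1 1 ⟨(s, l), Or.inr l.2⟩).trans (g2 1 s l)⟩

/-- The outcome of a transport is unique up to relative homotopy: in the prism over the constant
homotopy of `a`, the two transports are the ends and the top joins their outcomes. -/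
theorem IsCell.homotopicRel_of_transp (hK : IsCell n K L) {Γ : C(I × L, X)} {a b b' : C(K, X)}
    (h : Transp Γ a b) (h' : Transp Γ a b') : b.HomotopicRel b' L := by
  have hb := h.apply_one
  obtain ⟨H, h0, h1, h2⟩ := h
  obtain ⟨H', h0', h1', h2'⟩ := h'
  obtain ⟨N, n0, n1, n2⟩ := hK.exists_prism (a.comp ContinuousMap.snd) H H'
    (Γ.comp ⟨fun p => (p.1, p.2.2), by fun_prop⟩) h0 h0'
    (fun s l => (h2 0 l).symm.trans (h0 _)) (fun t l => (h2 t l).symm) (fun t l => (h2' t l).symm)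
  refine homotopicRel_iff.2 ⟨N, fun x => (n0 x).trans (h1 x), fun x => (n1 x).trans (h1' x),
    fun t x hx => (n2 t ⟨x, hx⟩).trans (hb ⟨x, hx⟩).symm⟩

/-- Here the prism stands on the given transport; one end stays at `a` and the other is the relative
homotopy from `b` to `b'`. -/
theorem IsCell.transp_of_homotopicRel (hK : IsCell n K L) {Γ : C(I × L, X)} {a b b' : C(K, X)}
    (h : Transp Γ a b) (h' : b.HomotopicRel b' L) : Transp Γ a b' := by
  have hb := h.apply_one
  have ha := h.apply_zero
  obtain ⟨H, h0, h1, h2⟩ := h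
  obtain ⟨G, g0, g1, g2⟩ := homotopicRel_iff.1 h'
  obtain ⟨N, n0, n1, n2⟩ := hK.exists_prism H (a.comp ContinuousMap.snd) G
    (Γ.comp ⟨fun p => (p.2.1, p.2.2), by fun_prop⟩) (fun x => (h0 x).symm)
    (fun x => (g0 x).trans (h1 x).symm)
    (fun s l => (h2 s l).symm) (fun t l => (ha l).symm)
    (fun t l => (hb l).symm.trans (g2 t l l.2).symm)
  exact ⟨N, n0, fun x => (n1 x).trans (g1 x), n2⟩

theorem IsCell.transp_of_homotopicRel_left (hK : IsCell n K L) {Γ : C(I × L, X)}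
    {a a' b : C(K, X)} (h : Transp Γ a b) (h' : a.HomotopicRel a' L) : Transp Γ a' b := by
  have := (hK.transp_of_homotopicRel h.symm h').symm
  rwa [revHtpy_revHtpy] at this

/-- `f` is injective on homotopy classes relative to `L` of maps with boundary value `φ`. -/
def CellInj (f : C(X, Y)) (φ : C(L, X)) : Prop :=
  ∀ a b : C(K, X), (∀ x : L, a x = φ x) → (∀ x : L, b x = φ x) →
    (f.comp a).HomotopicRel (f.comp b) L → a.HomotopicRel b L

/-- `f` is surjective on homotopy classes relative to `L` of maps with boundary value `φ`. -/
def CellSurj (f : C(X, Y)) (φ : C(L, X)) : Prop :=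
  ∀ b : C(K, Y), (∀ x : L, b x = f (φ x)) →
    ∃ a : C(K, X), (∀ x : L, a x = φ x) ∧ (f.comp a).HomotopicRel b L

/-- Transport along `Γ` and back identifies the relative homotopy classes over `φ` and over `φ'`,
compatibly with `f`. This plays the role of change of base point, for arbitrary boundary values. -/
theorem IsCell.cellInj_of_homotopy (hK : IsCell n K L) {f : C(X, Y)} {φ φ' : C(L, X)}
    (Γ : C(I × L, X)) (h0 : ∀ x, Γ (0, x) = φ x) (h1 : ∀ x, Γ (1, x) = φ' x)
    (h : CellInj f φ') : CellInj f φ := by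
  intro a a' ha ha' haa
  obtain ⟨b, hb⟩ := hK.exists_transp a Γ fun x => (h0 x).trans (ha x).symm
  obtain ⟨b', hb'⟩ := hK.exists_transp a' Γ fun x => (h0 x).trans (ha' x).symm
  have hbb : (f.comp b).HomotopicRel (f.comp b') L :=
    hK.homotopicRel_of_transp (hK.transp_of_homotopicRel_left (hb.map f) haa) (hb'.map f)
  have := h b b' (fun x => (hb.apply_one x).trans (h1 x))
    (fun x => (hb'.apply_one x).trans (h1 x)) hbb
  exact hK.homotopicRel_of_transp (hK.transp_of_homotopicRel_left hb.symm this) hb'.symm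

theorem IsCell.cellSurj_of_homotopy (hK : IsCell n K L) {f : C(X, Y)} {φ φ' : C(L, X)}
    (Γ : C(I × L, X)) (h0 : ∀ x, Γ (0, x) = φ x) (h1 : ∀ x, Γ (1, x) = φ' x)
    (h : CellSurj f φ') : CellSurj f φ := by
  intro c hc
  obtain ⟨d, hd⟩ := hK.exists_transp c (f.comp Γ) fun x =>
    (congrArg f (h0 x)).trans (hc x).symm
  obtain ⟨b, hb, hbd⟩ := h d fun x => (hd.apply_one x).trans (congrArg f (h1 x))
  obtain ⟨a, ha⟩ := hK.exists_transp b (revHtpy Γ) fun x => by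
    rw [hb, revHtpy_apply, symm_zero, h1]
  refine ⟨a, fun x => by rw [ha.apply_one, revHtpy_apply, symm_one, h0], ?_⟩
  exact hK.homotopicRel_of_transp (ha.map f)
    (hK.transp_of_homotopicRel_left hd.symm hbd.symm)

end Transport

/-! ### The lifting characterization of weak equivalences -/

section WeakLifting

variable {X : Type u} [TopologicalSpace X] {Y : Type v} [TopologicalSpace Y]

/-- The lifting property up to homotopy of `f` with respect to the pair `(K, L)`. -/
def RelLiftAt (f : C(X, Y)) (K : Type) [TopologicalSpace K] (L : Set K) : Prop :=
  ∀ (u : C(L, X)) (v : C(K, Y)), (∀ x : L, f (u x) = v x) →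
    ∃ w : C(K, X), (∀ x : L, w x = u x) ∧ (f.comp w).HomotopicRel v L

theorem RelLiftAt.of_homeomorph {f : C(X, Y)} {K K' : Type} [TopologicalSpace K]
    [TopologicalSpace K'] {L : Set K} {L' : Set K'} (h : RelLiftAt f K' L') (e : K ≃ₜ K')
    (he : ∀ x, x ∈ L ↔ e x ∈ L') : RelLiftAt f K L := by
  intro u v huv
  let k : C(L', L) := ⟨fun y => ⟨e.symm y, by rw [he, e.apply_symm_apply]; exact y.2⟩, by fun_prop⟩
  obtain ⟨w, hw, hwv⟩ := h (u.comp k) (v.comp ⟨e.symm, e.symm.continuous⟩) (fun x => huv _)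
  obtain ⟨H, h0, h1, h2⟩ := homotopicRel_iff.1 hwv
  refine ⟨w.comp ⟨e, e.continuous⟩, fun x => ?_, homotopicRel_iff.2
    ⟨H.comp ((ContinuousMap.id I).prodMap ⟨e, e.continuous⟩), fun x => h0 (e x), fun x => ?_,
      fun t x hx => h2 t (e x) ((he x).1 hx)⟩⟩
  · refine (hw ⟨e x, (he x).1 x.2⟩).trans (congrArg u (Subtype.ext (e.symm_apply_apply _)))
  · exact (h1 (e x)).trans (congrArg v (e.symm_apply_apply x))

theorem IsCell.exists_homeomorph {n : ℕ} {K K' : Type} [TopologicalSpace K]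
    [TopologicalSpace K'] {L : Set K} {L' : Set K'} (h : IsCell n K L) (h' : IsCell n K' L') :
    ∃ e : K ≃ₜ K', ∀ x, x ∈ L ↔ e x ∈ L' := by
  obtain ⟨e, he⟩ := h
  obtain ⟨e', he'⟩ := h'
  exact ⟨e.trans e'.symm, fun x => by simp [he, he']⟩

/-- The lifting property up to homotopy of `f` with respect to all cells. -/
def RelLift (f : C(X, Y)) : Prop :=
  ∀ (n : ℕ) (K : Type) [TopologicalSpace K] (L : Set K), IsCell n K L → RelLiftAt f K L

/-- Homotopic data have homotopic lifts. -/
theorem RelLift.exists_transp {f : C(X, Y)} (hf : RelLift f) {n : ℕ} {K : Type}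
    [TopologicalSpace K] {L : Set K} (hK : IsCell n K L) (u : C(L, X)) (v : C(K, Y))
    (Γ : C(I × L, Y)) (h0 : ∀ x, Γ (0, x) = f (u x)) (h1 : ∀ x : L, Γ (1, x) = v x) :
    ∃ w : C(K, X), (∀ x : L, w x = u x) ∧ Transp Γ (f.comp w) v := by
  -- Transporting `v` back along `Γ` makes its boundary value equal to `f ∘ u`, so that the strict
  -- form of the lifting property applies.
  obtain ⟨v', hv'⟩ := hK.exists_transp v (revHtpy Γ) fun x => by rw [revHtpy_apply, symm_zero, h1]
  obtain ⟨w, hw, hwv⟩ := hf n K L hK u v' fun x => by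
    rw [hv'.apply_one, revHtpy_apply, symm_one, h0]
  refine ⟨w, hw, ?_⟩
  have := hv'.symm
  rw [revHtpy_revHtpy] at this
  exact hK.transp_of_homotopicRel_left this hwv.symm

theorem bijective_homotopyGroupMap_iff (f : C(X, Y)) (n : ℕ) (x : X) :
    Function.Bijective (homotopyGroupMap f (Fin n) x) ↔
      CellInj f (ContinuousMap.const (Cube.boundary (Fin n)) x) ∧
      CellSurj f (ContinuousMap.const (Cube.boundary (Fin n)) x) := by
  constructor
  · rintro ⟨hi, hs⟩
    refine ⟨fun a a' ha ha' h => ?_, fun b hb => ?_⟩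
    · let α : GenLoop (Fin n) X x := ⟨a, fun y hy => ha ⟨y, hy⟩⟩
      let α' : GenLoop (Fin n) X x := ⟨a', fun y hy => ha' ⟨y, hy⟩⟩
      have : homotopyGroupMap f (Fin n) x (Quotient.mk _ α) =
          homotopyGroupMap f (Fin n) x (Quotient.mk _ α') := Quotient.sound h
      exact Quotient.exact (hi this)
    · let β : GenLoop (Fin n) Y (f x) := ⟨b, fun y hy => hb ⟨y, hy⟩⟩
      obtain ⟨α, hα⟩ := hs (Quotient.mk _ β)
      induction α using Quotient.inductionOn with | _ α => ?_
      exact ⟨α.1, fun y => α.2 y y.2, Quotient.exact hα⟩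
  · rintro ⟨hi, hs⟩
    refine ⟨fun α α' h => ?_, fun β => ?_⟩
    · induction α using Quotient.inductionOn with | _ α => ?_
      induction α' using Quotient.inductionOn with | _ α' => ?_
      exact Quotient.sound (hi α.1 α'.1 (fun y => α.2 y y.2) (fun y => α'.2 y y.2)
        (Quotient.exact h))
    · induction β using Quotient.inductionOn with | _ β => ?_
      obtain ⟨a, ha, hab⟩ := hs β.1 fun y => β.2 y y.2
      exact ⟨Quotient.mk _ ⟨a, fun y hy => ha ⟨y, hy⟩⟩, Quotient.sound hab⟩

theorem bijective_piZeroMap_iff (f : C(X, Y)) :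
    Function.Bijective (piZeroMap f) ↔
      (∀ x x', Joined (f x) (f x') → Joined x x') ∧ ∀ y, ∃ x, Joined (f x) y := by
  constructor
  · rintro ⟨hi, hs⟩
    refine ⟨fun x x' h => ?_, fun y => ?_⟩
    · have : piZeroMap f (Quotient.mk _ x) = piZeroMap f (Quotient.mk _ x') := Quotient.sound h
      exact Quotient.exact (hi this)
    · obtain ⟨x, hx⟩ := hs (Quotient.mk _ y)
      induction x using Quotient.inductionOn with | _ x => ?_
      exact ⟨x, Quotient.exact hx⟩
  · rintro ⟨hi, hs⟩
    refine ⟨fun x x' h => ?_, fun y => ?_⟩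
    · induction x using Quotient.inductionOn with | _ x => ?_
      induction x' using Quotient.inductionOn with | _ x' => ?_
      exact Quotient.sound (hi x x' (Quotient.exact h))
    · induction y using Quotient.inductionOn with | _ y => ?_
      obtain ⟨x, hx⟩ := hs y
      exact ⟨Quotient.mk _ x, Quotient.sound hx⟩

theorem isWeakEquiv_iff (f : C(X, Y)) : IsWeakEquiv f ↔
    ((∀ x x', Joined (f x) (f x') → Joined x x') ∧ ∀ y, ∃ x, Joined (f x) y) ∧
    ∀ (n : ℕ) (x : X), CellInj f (ContinuousMap.const (Cube.boundary (Fin (n + 1))) x) ∧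
      CellSurj f (ContinuousMap.const (Cube.boundary (Fin (n + 1))) x) := by
  rw [← bijective_piZeroMap_iff]
  simp only [← bijective_homotopyGroupMap_iff]
  exact ⟨fun h => ⟨h.bijective_piZero, h.bijective_pi⟩, fun h => ⟨f.continuous, h.1, h.2⟩⟩

/-- For the `0`-cube, a point with empty boundary; it puts path components in the same form as the
higher homotopy groups. -/
theorem homotopicRel_of_joined {K : Type} [TopologicalSpace K] [Unique K] {L : Set K}
    [IsEmpty L] {a b : C(K, X)} (h : Joined (a default) (b default)) : a.HomotopicRel b L := by
  obtain ⟨γ⟩ := h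
  refine homotopicRel_iff.2 ⟨γ.toContinuousMap.comp ContinuousMap.fst, fun x => ?_, fun x => ?_,
    fun t x hx => (IsEmpty.false (⟨x, hx⟩ : L)).elim⟩
  · rw [Subsingleton.elim x default]; exact γ.source
  · rw [Subsingleton.elim x default]; exact γ.target

theorem joined_of_homotopic {K : Type} [TopologicalSpace K] {L : Set K} {a b : C(K, X)}
    (h : a.HomotopicRel b L) (x : K) : Joined (a x) (b x) := by
  obtain ⟨H, h0, h1, -⟩ := homotopicRel_iff.1 h
  exact ⟨⟨H.comp ⟨fun t => (t, x), by fun_prop⟩, h0 x, h1 x⟩⟩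

instance : IsEmpty (Cube.boundary (Fin 0)) := ⟨fun x => x.2.elim fun i _ => i.elim0⟩

/-- A cube contracts to its origin. -/
def cubeContraction (n : ℕ) : C(I × (Fin n → I), Fin n → I) :=
  ⟨fun p i => σ p.1 * p.2 i, by fun_prop⟩

/-- Homotopy groups only treat constant boundary values. A boundary value that extends over the cube
is homotopic to a constant one, by contracting the cube to its origin. -/
theorem IsWeakEquiv.cellInj_and_cellSurj {f : C(X, Y)} (hf : IsWeakEquiv f) (n : ℕ)
    (U : C(Fin n → I, X)) :
    CellInj f (U.restrict (Cube.boundary (Fin n))) ∧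
      CellSurj f (U.restrict (Cube.boundary (Fin n))) := by
  obtain ⟨⟨hi, hs⟩, hf⟩ := (isWeakEquiv_iff f).1 hf
  cases n with
  | zero =>
    refine ⟨fun a a' _ _ h => homotopicRel_of_joined (hi _ _ (joined_of_homotopic h default)),
      fun b _ => ?_⟩
    obtain ⟨x, hx⟩ := hs (b default)
    exact ⟨ContinuousMap.const _ x, fun y => isEmptyElim y, homotopicRel_of_joined hx⟩
  | succ n =>
    let Γ : C(I × Cube.boundary (Fin (n + 1)), X) :=
      (U.comp (cubeContraction (n + 1))).comp
        ((ContinuousMap.id I).prodMap ⟨Subtype.val, continuous_subtype_val⟩)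
    have h0 : ∀ x, Γ (0, x) = U.restrict (Cube.boundary (Fin (n + 1))) x := fun x =>
      congrArg U (by ext i; simp [cubeContraction])
    have h1 : ∀ x, Γ (1, x) = ContinuousMap.const (Cube.boundary (Fin (n + 1))) (U 0) x := fun x =>
      congrArg U (by ext i; simp [cubeContraction])
    exact ⟨(isCell_cube _).cellInj_of_homotopy Γ h0 h1 (hf n (U 0)).1,
      (isCell_cube _).cellSurj_of_homotopy Γ h0 h1 (hf n (U 0)).2⟩

theorem IsWeakEquiv.relLiftAt_cube {f : C(X, Y)} (hf : IsWeakEquiv f) (n : ℕ) :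
    RelLiftAt f (Fin n → I) (Cube.boundary (Fin n)) := by
  cases n with
  | zero =>
    intro u v _
    obtain ⟨x, hx⟩ := ((isWeakEquiv_iff f).1 hf).1.2 (v default)
    exact ⟨ContinuousMap.const _ x, fun y => isEmptyElim y, homotopicRel_of_joined hx⟩
  | succ n =>
    -- it suffices to extend `u` over the cube
    suffices h : ∀ (u : C(Cube.boundary (Fin (n + 1)), X)) (v : C(Fin (n + 1) → I, Y)),
        (∀ x : Cube.boundary (Fin (n + 1)), f (u x) = v x) →
        ∃ w : C(Fin (n + 1) → I, X), ∀ x : Cube.boundary (Fin (n + 1)), w x = u x by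
      intro u v huv
      obtain ⟨w, hw⟩ := h u v huv
      obtain ⟨a, ha, hav⟩ := (hf.cellInj_and_cellSurj (n + 1) w).2 v fun x => by
        rw [← huv, ← hw]; rfl
      exact ⟨a, fun x => (ha x).trans (hw x), hav⟩
    intro u v huv
    have hK := isCell_cube n
    have hC := isCell_unitInterval.prod hK
    rw [add_comm] at hC
    obtain ⟨e, he⟩ := hC.exists_homeomorph (isCell_cube (n + 1))
    let k : C(prodBd ({0, 1} : Set I) (Cube.boundary (Fin n)), Cube.boundary (Fin (n + 1))) :=
      ⟨fun y => ⟨e y, (he y).1 y.2⟩, by fun_prop⟩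
    let u' := u.comp k
    let v' : C(I × (Fin n → I), Y) := v.comp ⟨e, e.continuous⟩
    have huv' : ∀ x, f (u' x) = v' x := fun x => huv _
    let u₀ : C(Fin n → I, X) := u'.comp ⟨fun x => ⟨(0, x), Or.inl (Or.inl rfl)⟩, by fun_prop⟩
    let u₁ : C(Fin n → I, X) := u'.comp ⟨fun x => ⟨(1, x), Or.inl (Or.inr rfl)⟩, by fun_prop⟩
    let Γ : C(I × Cube.boundary (Fin n), X) :=
      u'.comp ⟨fun p => ⟨(p.1, p.2), Or.inr p.2.2⟩, by fun_prop⟩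
    -- With the cube seen as `I × Iⁿ`, the map `u` consists of two ends `u₀`, `u₁` and a side `Γ`.
    -- The map `v` shows that `f ∘ u₁` is a transport of `f ∘ u₀` along `f ∘ Γ`, as is `f ∘ b`. By
    -- uniqueness of transport and injectivity `b` is homotopic to `u₁`, so `u₁` is itself a
    -- transport of `u₀` along `Γ`; the transporting homotopy is the extension.
    obtain ⟨b, hb⟩ := hK.exists_transp u₀ Γ fun x => rfl
    have hv : Transp (f.comp Γ) (f.comp u₀) (f.comp u₁) :=
      ⟨v', fun x => (huv' ⟨(0, x), Or.inl (Or.inl rfl)⟩).symm,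
        fun x => (huv' ⟨(1, x), Or.inl (Or.inr rfl)⟩).symm,
        fun t x => (huv' ⟨(t, x), Or.inr x.2⟩).symm⟩
    have hbu : b.HomotopicRel u₁ (Cube.boundary (Fin n)) :=
      (hf.cellInj_and_cellSurj n u₁).1 b u₁ hb.apply_one (fun x => rfl)
        (hK.homotopicRel_of_transp (hb.map f) hv)
    obtain ⟨H, h0, h1, h2⟩ := hK.transp_of_homotopicRel hb hbu
    refine ⟨H.comp ⟨e.symm, e.symm.continuous⟩, fun x => ?_⟩
    have key : ∀ y : prodBd ({0, 1} : Set I) (Cube.boundary (Fin n)), H y = u' y := by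
      intro y
      induction y using prodBd_induction with
      | h0 x => exact h0 x
      | h1 x => exact h1 x
      | h2 s l => exact h2 s l
    refine (key ⟨e.symm x, by rw [he, e.apply_symm_apply]; exact x.2⟩).trans ?_
    exact congrArg u (Subtype.ext (e.apply_symm_apply _))

theorem IsWeakEquiv.relLift {f : C(X, Y)} (hf : IsWeakEquiv f) : RelLift f := by
  intro n K _ L hK
  obtain ⟨e, he⟩ := hK
  exact (hf.relLiftAt_cube n).of_homeomorph e he

/-- A relative homotopy from `f ∘ a` to `f ∘ a'` is a map on the cell `I × K` whose lift is
prescribed on the boundary by `a`, `a'` and `φ`. Only the boundary values of the lift matter. -/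
theorem RelLift.cellInj {f : C(X, Y)} (hf : RelLift f) {n : ℕ} {K : Type} [TopologicalSpace K]
    {L : Set K} (hK : IsCell n K L) (φ : C(L, X)) : CellInj f φ := by
  intro a a' ha ha' h
  have := hK.compactSpace
  have := hK.t2Space
  have := hK.compactSpace_bd
  obtain ⟨H, h0, h1, h2⟩ := homotopicRel_iff.1 h
  obtain ⟨G, g0, g1, g2⟩ := exists_glue_cylinder (Z := Unit) (a.comp ContinuousMap.snd)
    (a'.comp ContinuousMap.snd) (φ.comp (ContinuousMap.snd.comp ContinuousMap.snd))
    (fun _ l => (ha l).symm) (fun _ l => (ha' l).symm)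
  obtain ⟨w, hw, -⟩ := hf _ _ _ (isCell_unitInterval.prod hK)
    (G.comp ⟨fun x => ((), x), by fun_prop⟩) H (by
      intro y
      induction y using prodBd_induction with
      | h0 x => exact (congrArg f (g0 () x)).trans (h0 x).symm
      | h1 x => exact (congrArg f (g1 () x)).trans (h1 x).symm
      | h2 s l =>
        exact (congrArg f (g2 () s l)).trans
          ((h2 s l l.2).trans (congrArg f (ha l))).symm)
  exact homotopicRel_iff.2 ⟨w, fun x => (hw ⟨(0, x), Or.inl (Or.inl rfl)⟩).trans (g0 () x),
    fun x => (hw ⟨(1, x), Or.inl (Or.inr rfl)⟩).trans (g1 () x),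
    fun t x hx => (hw ⟨(t, x), Or.inr hx⟩).trans ((g2 () t ⟨x, hx⟩).trans (ha ⟨x, hx⟩).symm)⟩

theorem RelLift.isWeakEquiv {f : C(X, Y)} (hf : RelLift f) : IsWeakEquiv f := by
  refine (isWeakEquiv_iff f).2 ⟨⟨fun x x' h => ?_, fun y => ?_⟩, fun n x => ⟨?_, fun b hb => ?_⟩⟩
  · have := hf.cellInj (isCell_cube 0) ⟨fun y => isEmptyElim y, continuous_of_discreteTopology⟩
      (ContinuousMap.const _ x) (ContinuousMap.const _ x') (fun y => isEmptyElim y)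
      (fun y => isEmptyElim y) (homotopicRel_of_joined h)
    exact joined_of_homotopic this default
  · obtain ⟨w, -, hw⟩ := hf 0 _ _ (isCell_cube 0)
      ⟨fun y => isEmptyElim y, continuous_of_discreteTopology⟩ (ContinuousMap.const _ y)
      (fun y => isEmptyElim y)
    exact ⟨w default, joined_of_homotopic hw default⟩
  · exact hf.cellInj (isCell_cube _) _
  · exact hf _ _ _ (isCell_cube _) _ b fun x => (hb x).symm

end WeakLifting

/-! ### Closure properties of weak equivalences -/

section TwoOutOfThree

variable {X : Type*} [TopologicalSpace X] {Y : Type*} [TopologicalSpace Y] {Z : Type*}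
  [TopologicalSpace Z]

theorem piZeroMap_comp (f : C(X, Y)) (g : C(Y, Z)) :
    piZeroMap (g.comp f) = piZeroMap g ∘ piZeroMap f := by
  funext x
  induction x using Quotient.inductionOn with | _ x => rfl

theorem homotopyGroupMap_comp (f : C(X, Y)) (g : C(Y, Z)) (N : Type) (x : X) :
    homotopyGroupMap (g.comp f) N x = homotopyGroupMap g N (f x) ∘ homotopyGroupMap f N x := by
  funext a
  induction a using Quotient.inductionOn with | _ a => rfl

theorem IsWeakEquiv.comp {f : X → Y} {g : Y → Z} (hg : IsWeakEquiv g) (hf : IsWeakEquiv f) :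
    IsWeakEquiv (g ∘ f) where
  continuous := hg.continuous.comp hf.continuous
  bijective_piZero := by
    have := hg.bijective_piZero.comp hf.bijective_piZero
    rwa [← piZeroMap_comp] at this
  bijective_pi n x := by
    have := (hg.bijective_pi n (f x)).comp (hf.bijective_pi n x)
    exact (homotopyGroupMap_comp ⟨f, hf.continuous⟩ ⟨g, hg.continuous⟩ _ x) ▸ this

theorem IsWeakEquiv.of_comp_left {f : X → Y} {g : Y → Z} (hf : Continuous f)
    (hg : IsWeakEquiv g) (hgf : IsWeakEquiv (g ∘ f)) : IsWeakEquiv f where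
  continuous := hf
  bijective_piZero := by
    have := hgf.bijective_piZero
    rw [← hg.bijective_piZero.of_comp_iff', ← piZeroMap_comp]
    exact this
  bijective_pi n x := by
    have := hgf.bijective_pi n x
    rw [← (hg.bijective_pi n (f x)).of_comp_iff']
    exact (homotopyGroupMap_comp ⟨f, hf⟩ ⟨g, hg.continuous⟩ _ x) ▸ this

/-- The induced maps on homotopy groups at two points that are joined by a path are both bijective
or both not. -/
theorem bijective_homotopyGroupMap_of_joined (f : C(X, Y)) (n : ℕ) {x x' : X} (h : Joined x x')
    (h' : Function.Bijective (homotopyGroupMap f (Fin n) x')) :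
    Function.Bijective (homotopyGroupMap f (Fin n) x) := by
  obtain ⟨γ⟩ := h
  rw [bijective_homotopyGroupMap_iff] at h' ⊢
  let Γ : C(I × Cube.boundary (Fin n), X) := γ.toContinuousMap.comp ContinuousMap.fst
  have h1 : ∀ l, Γ (1, l) = ContinuousMap.const (Cube.boundary (Fin n)) x' l := fun _ => γ.target
  exact ⟨(isCell_cube n).cellInj_of_homotopy Γ (fun _ => γ.source) h1 h'.1,
    (isCell_cube n).cellSurj_of_homotopy Γ (fun _ => γ.source) h1 h'.2⟩

theorem IsWeakEquiv.of_comp_right {f : X → Y} {g : Y → Z} (hg : Continuous g)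
    (hf : IsWeakEquiv f) (hgf : IsWeakEquiv (g ∘ f)) : IsWeakEquiv g where
  continuous := hg
  bijective_piZero := by
    have := hgf.bijective_piZero
    rw [← hf.bijective_piZero.of_comp_iff, ← piZeroMap_comp]
    exact this
  bijective_pi n y := by
    -- The base point `y` need not be in the image of `f`, but it is joined to a point of the image
    -- by a path.
    obtain ⟨x, hx⟩ := ((bijective_piZeroMap_iff _).1 hf.bijective_piZero).2 y
    refine bijective_homotopyGroupMap_of_joined _ _ hx.symm ?_
    have := hgf.bijective_pi n x
    refine (Function.Bijective.of_comp_iff _ (hf.bijective_pi n x)).1 ?_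
    exact (homotopyGroupMap_comp ⟨f, hf.continuous⟩ ⟨g, hg⟩ _ x) ▸ this

theorem IsWeakEquiv.of_comp_of_comp {f : X → Y} {g : Y → X} (hf : Continuous f)
    (hg : Continuous g) (hgf : IsWeakEquiv (g ∘ f)) (hfg : IsWeakEquiv (f ∘ g)) :
    IsWeakEquiv f where
  continuous := hf
  bijective_piZero := by
    have h1 := hgf.bijective_piZero
    have h2 := hfg.bijective_piZero
    have e1 := piZeroMap_comp ⟨f, hf⟩ ⟨g, hg⟩
    have e2 := piZeroMap_comp ⟨g, hg⟩ ⟨f, hf⟩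
    have h1' := e1 ▸ h1
    have h2' := e2 ▸ h2
    exact ⟨h1'.1.of_comp, h2'.2.of_comp⟩
  bijective_pi n x := by
    have h1 := homotopyGroupMap_comp ⟨f, hf⟩ ⟨g, hg⟩ _ x ▸ hgf.bijective_pi n x
    have h2 := homotopyGroupMap_comp ⟨g, hg⟩ ⟨f, hf⟩ _ (f x) ▸ hfg.bijective_pi n (f x)
    -- The group map of `g` at `f x` is the first factor of one bijection and the last factor of the
    -- other, hence bijective, and it can be cancelled.
    exact (Function.Bijective.of_comp_iff' ⟨h2.1.of_comp, h1.2.of_comp⟩ _).1 h1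

/-- A map homotopic to a weak equivalence is a weak equivalence. The homotopy needs to be
continuous only along cells. -/
theorem IsWeakEquiv.of_homotopy {f₀ f₁ : X → Y} (hf₀ : IsWeakEquiv f₀) (hf₁ : Continuous f₁)
    (Φ : I → X → Y) (h0 : ∀ x, Φ 0 x = f₀ x) (h1 : ∀ x, Φ 1 x = f₁ x)
    (hΦ : ∀ (n : ℕ) (K : Type) [TopologicalSpace K] (L : Set K), IsCell n K L →
      ∀ a : C(K, X), Continuous fun p : I × K => Φ p.1 (a p.2)) : IsWeakEquiv f₁ := by
  let F₀ : C(X, Y) := ⟨f₀, hf₀.continuous⟩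
  let F₁ : C(X, Y) := ⟨f₁, hf₁⟩
  have path : ∀ x, Continuous fun t => Φ t x := fun x =>
    (hΦ 0 _ _ (isCell_cube 0) (ContinuousMap.const _ x)).comp
      (continuous_id.prodMk (continuous_const (y := default)))
  have hj : ∀ x, Joined (f₀ x) (f₁ x) := fun x => ⟨⟨⟨fun t => Φ t x, path x⟩, h0 x, h1 x⟩⟩
  obtain ⟨⟨hi, hs⟩, hn⟩ := (isWeakEquiv_iff F₀).1 hf₀
  refine (isWeakEquiv_iff F₁).2 ⟨⟨fun x x' h => hi x x' ?_, fun y => ?_⟩, fun n x => ?_⟩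
  · exact ((hj x).trans h).trans (hj x').symm
  · obtain ⟨x, hx⟩ := hs y
    exact ⟨x, (hj x).symm.trans hx⟩
  · have hK := isCell_cube (n + 1)
    let Γ : C(I × Cube.boundary (Fin (n + 1)), Y) := ⟨fun p => Φ p.1 x, (path x).comp continuous_fst⟩
    -- The homotopy moves the base point `f₀ x` along the path `Γ`, so `f₁ ∘ a` is the transport of
    -- `f₀ ∘ a` along that path and not a relatively homotopic map.
    have tr : ∀ a : C(Fin (n + 1) → I, X), (∀ l : Cube.boundary (Fin (n + 1)), a l = x) →
        Transp Γ (F₀.comp a) (F₁.comp a) := fun a ha =>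
      ⟨⟨fun p => Φ p.1 (a p.2), hΦ _ _ _ hK a⟩, fun z => h0 _, fun z => h1 _,
        fun t l => congrArg (Φ t) (ha l)⟩
    refine ⟨fun a a' ha ha' h => (hn n x).1 a a' ha ha' ?_, fun b hb => ?_⟩
    · exact hK.homotopicRel_of_transp
        (hK.transp_of_homotopicRel_left (tr a ha).symm h) (tr a' ha').symm
    · obtain ⟨b', hb'⟩ := hK.exists_transp b (revHtpy Γ) fun l => by
        rw [revHtpy_apply, symm_zero, hb]; exact h1 x
      obtain ⟨a, ha, hab⟩ := (hn n x).2 b' fun l => by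
        rw [hb'.apply_one, revHtpy_apply, symm_one]; exact h0 x
      refine ⟨a, ha, hK.homotopicRel_of_transp (tr a ha) ?_⟩
      have := hb'.symm
      rw [revHtpy_revHtpy] at this
      exact hK.transp_of_homotopicRel_left this hab.symm

end TwoOutOfThree

end SpaceLocalization

namespace SpaceLocalization

/-! ### Simplices -/

/-- The boundary of a simplex. -/
def simplexBd (n : ℕ) : Set (stdSimplex ℝ (Fin (n + 1))) := {p | ∃ i, p i = 0}

/-- The simplex in `ℝⁿ` spanned by the origin and the standard basis. -/
def cornerSimplex (n : ℕ) : Set (Fin n → ℝ) := {x | (∀ i, 0 ≤ x i) ∧ ∑ i, x i ≤ 1}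

theorem convex_cornerSimplex (n : ℕ) : Convex ℝ (cornerSimplex n) := by
  rintro x ⟨hx, hx'⟩ y ⟨hy, hy'⟩ a b ha hb hab
  refine ⟨fun i => ?_, ?_⟩
  · exact add_nonneg (mul_nonneg ha (hx i)) (mul_nonneg hb (hy i))
  · simp only [Pi.add_apply, Pi.smul_apply, smul_eq_mul, Finset.sum_add_distrib, ← Finset.mul_sum]
    nlinarith

theorem isClosed_cornerSimplex (n : ℕ) : IsClosed (cornerSimplex n) := by
  have : cornerSimplex n = (⋂ i, {x | 0 ≤ x i}) ∩ {x | ∑ i, x i ≤ 1} := by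
    ext x; simp [cornerSimplex]
  rw [this]
  exact (isClosed_iInter fun i => isClosed_le continuous_const (continuous_apply i)).inter
    (isClosed_le (by fun_prop) continuous_const)

theorem isBounded_cornerSimplex (n : ℕ) : Bornology.IsBounded (cornerSimplex n) := by
  refine (Metric.isBounded_Icc (0 : Fin n → ℝ) 1).subset fun x hx => ⟨hx.1, fun i => ?_⟩
  exact (Finset.single_le_sum (fun j _ => hx.1 j) (Finset.mem_univ i)).trans hx.2

theorem mem_interior_cornerSimplex (n : ℕ) (x : Fin n → ℝ) :
    x ∈ interior (cornerSimplex n) ↔ (∀ i, 0 < x i) ∧ ∑ i, x i < 1 := by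
  constructor
  · intro hx
    -- An interior point can be moved slightly in any direction. Moving along `-1` gives positive
    -- coordinates, and along `1` a sum less than `1`; for `n = 0` that sum is empty.
    have key : ∀ v : Fin n → ℝ, ∃ δ : ℝ, 0 < δ ∧ x + δ • v ∈ cornerSimplex n := by
      intro v
      have hc : Filter.Tendsto (fun δ : ℝ => x + δ • v) (𝓝 0) (𝓝 x) := by
        have : Continuous fun δ : ℝ => x + δ • v := by fun_prop
        simpa using this.tendsto 0
      have h1 := (hc.eventually (mem_interior_iff_mem_nhds.1 hx)).filter_mono
        (nhdsWithin_le_nhds (s := Set.Ioi 0))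
      obtain ⟨δ, h, h'⟩ := (h1.and self_mem_nhdsWithin).exists
      exact ⟨δ, h', h⟩
    refine ⟨fun i => ?_, ?_⟩
    · obtain ⟨δ, hδ, h⟩ := key (-1)
      have := h.1 i
      simp at this
      linarith
    · rcases n with _ | n
      · simp
      · obtain ⟨δ, hδ, h⟩ := key 1
        have := h.2
        simp [Finset.sum_add_distrib] at this
        nlinarith
  · rintro ⟨h0, h1⟩
    have ho : IsOpen ((⋂ i, {x : Fin n → ℝ | 0 < x i}) ∩ {x | ∑ i, x i < 1}) :=
      (isOpen_iInter_of_finite fun i => isOpen_lt continuous_const (continuous_apply i)).inter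
        (isOpen_lt (by fun_prop) continuous_const)
    have hs : (⋂ i, {x : Fin n → ℝ | 0 < x i}) ∩ {x | ∑ i, x i < 1} ⊆ cornerSimplex n :=
      fun y hy => ⟨fun i => (Set.mem_iInter.1 hy.1 i).le, hy.2.le⟩
    exact interior_maximal hs ho ⟨Set.mem_iInter.2 h0, h1⟩

/-- The standard simplex, seen from its first vertex. -/
def stdSimplexHomeoCorner (n : ℕ) : stdSimplex ℝ (Fin (n + 1)) ≃ₜ cornerSimplex n where
  toFun p := ⟨fun i => p i.succ, fun i => p.2.1 _, by
    have := p.2.2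
    rw [Fin.sum_univ_succ] at this
    have h0 := p.2.1 0
    change ∑ i : Fin n, p.1 i.succ ≤ 1
    linarith⟩
  invFun x := ⟨Fin.cons (1 - ∑ i, x.1 i) x.1, fun i => by
      refine Fin.cases ?_ (fun j => ?_) i
      · simpa using x.2.2
      · simpa using x.2.1 j, by
      rw [Fin.sum_univ_succ]; simp⟩
  left_inv p := by
    apply Subtype.ext
    funext i
    have := p.2.2
    rw [Fin.sum_univ_succ] at this
    refine Fin.cases ?_ (fun j => ?_) i
    · change 1 - ∑ i : Fin n, p.1 i.succ = p.1 0
      linarith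
    · rfl
  right_inv x := rfl
  continuous_toFun := Continuous.subtype_mk (continuous_pi fun i =>
    (continuous_apply i.succ).comp continuous_subtype_val) _
  continuous_invFun := Continuous.subtype_mk (continuous_pi fun i => by
    refine Fin.cases ?_ (fun j => ?_) i
    · simp only [Fin.cons_zero]; fun_prop
    · simp only [Fin.cons_succ]
      exact (continuous_apply j).comp continuous_subtype_val) _

/-- A bounded convex set with nonempty interior is homeomorphic to the ball, frontier to sphere.
This is applied to the corner simplex, since the standard simplex has empty interior in its ambient
space. -/
theorem isCell_stdSimplex (n : ℕ) : IsCell n (stdSimplex ℝ (Fin (n + 1))) (simplexBd n) := by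
  obtain ⟨h, h1, h2, h3⟩ := exists_homeomorph_image_interior_closure_frontier_eq_unitBall
    (convex_cornerSimplex n) (by
      refine ⟨fun _ => 1 / (n + 1), (mem_interior_cornerSimplex n _).2 ⟨fun i => by positivity, ?_⟩⟩
      rw [Finset.sum_const, Finset.card_univ, Fintype.card_fin, nsmul_eq_mul, mul_one_div,
        div_lt_one (by positivity)]
      linarith) (isBounded_cornerSimplex n)
  rw [(isClosed_cornerSimplex n).closure_eq] at h2
  let e : cornerSimplex n ≃ₜ Metric.closedBall (0 : Fin n → ℝ) 1 :=
    (h.image (cornerSimplex n)).trans (Homeomorph.setCongr h2)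
  refine ⟨((stdSimplexHomeoCorner n).trans e).trans (cubeHomeoBall n).symm, fun p => ?_⟩
  rw [← norm_cubeHomeoBall_eq_one_iff]
  simp only [Homeomorph.trans_apply, Homeomorph.apply_symm_apply]
  rw [← mem_sphere_zero_iff_norm, ← h3]
  change _ ↔ h (stdSimplexHomeoCorner n p) ∈ h '' _
  rw [h.injective.mem_set_image, (isClosed_cornerSimplex n).frontier_eq, Set.mem_sdiff,
    mem_interior_cornerSimplex]
  have hs := p.2.2
  rw [Fin.sum_univ_succ] at hs
  have e0 : ∑ i, (stdSimplexHomeoCorner n p : Fin n → ℝ) i = ∑ i : Fin n, p.1 i.succ := rfl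
  have hp0 : (∃ i, p.1 i = 0) ↔ ¬ ∀ i, 0 < p.1 i := by
    rw [not_forall]
    exact exists_congr fun i => ⟨fun h => by rw [h]; exact lt_irrefl _,
      fun h => le_antisymm (not_lt.1 h) (p.2.1 i)⟩
  change (∃ i, p.1 i = 0) ↔ _
  rw [hp0, Fin.forall_fin_succ, e0]
  constructor
  · exact fun h => ⟨Subtype.prop _, fun h' => h ⟨by linarith [h'.2], h'.1⟩⟩
  · exact fun h h' => h.2 ⟨h'.2, by linarith [h'.1]⟩

/-! ### Faces of simplices and factorization of monotone maps -/

section SimplexMap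

variable {k l m n : ℕ}

theorem stdSimplex_map_apply (θ : Fin (m + 1) → Fin (n + 1)) (p : stdSimplex ℝ (Fin (m + 1)))
    (i : Fin (n + 1)) : stdSimplex.map θ p i = ∑ j with θ j = i, p j := by
  rw [stdSimplex.map_coe, FunOnFinite.linearMap_apply_apply]

theorem stdSimplex_map_apply_of_injective {θ : Fin (m + 1) → Fin (n + 1)}
    (hθ : Function.Injective θ) (p : stdSimplex ℝ (Fin (m + 1))) (j : Fin (m + 1)) :
    stdSimplex.map θ p (θ j) = p j := by
  rw [stdSimplex_map_apply, Finset.sum_eq_single j]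
  · intro i hi hij
    exact absurd (hθ (Finset.mem_filter.1 hi).2) hij
  · simp

theorem stdSimplex_map_injective {θ : Fin (m + 1) → Fin (n + 1)} (hθ : Function.Injective θ) :
    Function.Injective (stdSimplex.map (S := ℝ) θ) := by
  intro p q h
  ext j
  rw [← stdSimplex_map_apply_of_injective hθ p, h, stdSimplex_map_apply_of_injective hθ]

theorem exists_of_stdSimplex_map_ne_zero {θ : Fin (m + 1) → Fin (n + 1)}
    {p : stdSimplex ℝ (Fin (m + 1))} {i : Fin (n + 1)} (h : stdSimplex.map θ p i ≠ 0) :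
    ∃ j, θ j = i := by
  by_contra hj
  push Not at hj
  apply h
  rw [stdSimplex_map_apply, Finset.filter_false_of_mem fun j _ => hj j, Finset.sum_empty]

/-- Every nonempty set of vertices spans a face. -/
theorem exists_orderHom_range (A : Finset (Fin (n + 1))) (hA : A.Nonempty) :
    ∃ (r : ℕ) (ζ : Fin (r + 1) →o Fin (n + 1)), Function.Injective ζ ∧ Set.range ζ = A := by
  obtain ⟨r, hr⟩ := Nat.exists_eq_succ_of_ne_zero (Finset.card_pos.2 hA).ne'
  exact ⟨r, (A.orderEmbOfFin hr).toOrderHom, (A.orderEmbOfFin hr).injective,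
    A.range_orderEmbOfFin hr⟩

/-- Every point of a simplex is an interior point of a face. -/
theorem exists_face (p : stdSimplex ℝ (Fin (n + 1))) :
    ∃ (r : ℕ) (ζ : Fin (r + 1) →o Fin (n + 1)) (s : stdSimplex ℝ (Fin (r + 1))),
      Function.Injective ζ ∧ stdSimplex.map ζ s = p ∧ ∀ j, p (ζ j) ≠ 0 := by
  classical
  let A : Finset (Fin (n + 1)) := {i | p i ≠ 0}
  have hA : A.Nonempty := by
    by_contra h
    rw [Finset.not_nonempty_iff_eq_empty, Finset.filter_eq_empty_iff] at h
    have := stdSimplex.sum_eq_one p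
    rw [Finset.sum_eq_zero fun i hi => not_not.1 (h hi)] at this
    exact zero_ne_one this
  obtain ⟨r, ζ, hζ, hr⟩ := exists_orderHom_range A hA
  have hmem : ∀ j, p (ζ j) ≠ 0 := fun j => by
    have : ζ j ∈ (A : Set _) := hr ▸ Set.mem_range_self j
    simpa [A] using this
  have hout : ∀ i, (¬ ∃ j, ζ j = i) → p i = 0 := fun i hi => by
    by_contra h
    apply hi
    have : i ∈ (A : Set _) := by simpa [A] using h
    rw [← hr] at this
    exact this
  have hsum : ∑ j, p (ζ j) = 1 := by
    rw [← stdSimplex.sum_eq_one p, ← Finset.sum_subset (Finset.subset_univ (Finset.univ.image ζ)),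
      Finset.sum_image fun _ _ _ _ h => hζ h]
    intro i _ hi
    exact hout i fun ⟨j, hj⟩ => hi (Finset.mem_image.2 ⟨j, Finset.mem_univ _, hj⟩)
  refine ⟨r, ζ, ⟨fun j => p (ζ j), fun j => p.2.1 _, hsum⟩, hζ, ?_, hmem⟩
  ext i
  by_cases hi : ∃ j, ζ j = i
  · obtain ⟨j, rfl⟩ := hi
    rw [stdSimplex_map_apply_of_injective hζ]
    rfl
  · rw [hout i hi]
    by_contra h
    exact hi (exists_of_stdSimplex_map_ne_zero h)

theorem exists_orderHom_comp {θ : Fin (l + 1) →o Fin (n + 1)} (hθ : Function.Injective θ)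
    (ζ : Fin (m + 1) →o Fin (n + 1)) (h : ∀ j, ∃ i, θ i = ζ j) :
    ∃ η : Fin (m + 1) →o Fin (l + 1), θ.comp η = ζ := by
  choose η hη using h
  have hs : StrictMono θ := θ.monotone.strictMono_of_injective hθ
  refine ⟨⟨η, fun a b hab => ?_⟩, ?_⟩
  · rw [← hs.le_iff_le, hη, hη]
    exact ζ.monotone hab
  · ext j
    exact congrArg _ (hη j)

/-- A point common to two faces comes from a common subface. -/
theorem exists_common_face {l' : ℕ} {θ : Fin (l + 1) →o Fin (n + 1)}
    {θ' : Fin (l' + 1) →o Fin (n + 1)} (hθ : Function.Injective θ) (hθ' : Function.Injective θ')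
    {q : stdSimplex ℝ (Fin (l + 1))} {q' : stdSimplex ℝ (Fin (l' + 1))}
    (h : stdSimplex.map θ q = stdSimplex.map θ' q') :
    ∃ (r : ℕ) (η : Fin (r + 1) →o Fin (l + 1)) (η' : Fin (r + 1) →o Fin (l' + 1))
      (s : stdSimplex ℝ (Fin (r + 1))), r ≤ l ∧ θ.comp η = θ'.comp η' ∧ q = stdSimplex.map η s ∧
        q' = stdSimplex.map η' s := by
  obtain ⟨r, ζ, s, hζ, hs, hne⟩ := exists_face (stdSimplex.map θ q)
  obtain ⟨η, hη⟩ := exists_orderHom_comp hθ ζ fun j => exists_of_stdSimplex_map_ne_zero (hne j)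
  obtain ⟨η', hη'⟩ := exists_orderHom_comp hθ' ζ fun j =>
    exists_of_stdSimplex_map_ne_zero (h ▸ hne j)
  refine ⟨r, η, η', s, ?_, hη.trans hη'.symm, ?_, ?_⟩
  · have : Function.Injective η := by
      refine Function.Injective.of_comp (f := θ) ?_
      rwa [← hη] at hζ
    simpa using Fintype.card_le_of_injective _ this
  · apply stdSimplex_map_injective hθ
    rw [stdSimplex.map_comp_apply, ← hs, ← hη]
    rfl
  · apply stdSimplex_map_injective hθ'
    rw [stdSimplex.map_comp_apply, ← h, ← hs, ← hη']
    rfl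

/-- Factorization of a monotone map into a surjection and an injection. -/
theorem exists_factorization (θ : Fin (m + 1) →o Fin (n + 1)) :
    ∃ (l : ℕ) (ε : Fin (m + 1) →o Fin (l + 1)) (δ : Fin (l + 1) →o Fin (n + 1)),
      Function.Surjective ε ∧ Function.Injective δ ∧ δ.comp ε = θ := by
  classical
  obtain ⟨l, δ, hδ, hr⟩ := exists_orderHom_range (Finset.univ.image θ) (by simp)
  have hr' : Set.range δ = Set.range θ := by simpa using hr
  obtain ⟨ε, hε⟩ := exists_orderHom_comp hδ θ fun j => by
    have : θ j ∈ Set.range δ := hr' ▸ Set.mem_range_self j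
    exact this
  refine ⟨l, ε, δ, fun i => ?_, hδ, hε⟩
  have : δ i ∈ Set.range θ := hr' ▸ Set.mem_range_self i
  obtain ⟨j, hj⟩ := this
  refine ⟨j, hδ ?_⟩
  rw [← hj, ← hε]
  rfl

theorem le_of_injective_orderHom {δ : Fin (l + 1) →o Fin (n + 1)} (hδ : Function.Injective δ) :
    l ≤ n := by
  simpa using Fintype.card_le_of_injective _ hδ

theorem lt_of_injective_orderHom {δ : Fin (l + 1) →o Fin (n + 1)} (hδ : Function.Injective δ)
    (h : ¬ Function.Surjective δ) : l < n := by
  simpa using Fintype.card_lt_of_injective_not_surjective _ hδ h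

theorem le_of_surjective_orderHom {ε : Fin (m + 1) →o Fin (l + 1)} (hε : Function.Surjective ε) :
    l ≤ m := by
  simpa using Fintype.card_le_of_surjective _ hε

theorem orderHom_eq_id_of_surjective {θ : Fin (n + 1) →o Fin (n + 1)}
    (hθ : Function.Surjective θ) : θ = OrderHom.id := by
  have hi : Function.Injective θ := Finite.injective_iff_surjective.2 hθ
  have hs : StrictMono θ := θ.monotone.strictMono_of_injective hi
  have := Subsingleton.elim (hs.orderIsoOfSurjective θ hθ) (OrderIso.refl _)
  ext x
  exact congrArg (fun e : Fin (n + 1) ≃o Fin (n + 1) => ((e x : Fin (n + 1)) : ℕ)) this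

/-- The values of a point of the homotopy limit live at last vertices, so preserving the last vertex
is what makes the action of a degeneracy invertible. -/
theorem orderHom_last_of_surjective {ε : Fin (m + 1) →o Fin (l + 1)}
    (hε : Function.Surjective ε) : ε (Fin.last m) = Fin.last l := by
  obtain ⟨j, hj⟩ := hε (Fin.last l)
  exact le_antisymm (Fin.le_last _) (hj ▸ ε.monotone (Fin.le_last j))

end SimplexMap

/-! ### Chains in a category -/

section Chains

variable {J : Type w} [Category.{w'} J] {l m n : ℕ}

/-- The action of monotone maps on chains. -/
abbrev pull (θ : Fin (m + 1) →o Fin (n + 1)) (σ : ComposableArrows J n) : ComposableArrows J m :=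
  θ.monotone.functor ⋙ σ

/-- A chain is nondegenerate if it is so as a simplex of the nerve. -/
def NonDeg (σ : ComposableArrows J n) : Prop := σ ∈ (nerve J).nonDegenerate n

theorem not_nonDeg_pull (h : n < m) (θ : Fin (m + 1) →o Fin (n + 1)) (σ : ComposableArrows J n) :
    ¬ NonDeg (pull θ σ) := fun h' =>
  h' ⟨n, h, SimplexCategory.Hom.mk θ, ⟨σ, rfl⟩⟩

theorem exists_nonDeg (σ : ComposableArrows J n) :
    ∃ (m : ℕ) (θ : Fin (n + 1) →o Fin (m + 1)) (τ : ComposableArrows J m),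
      Function.Surjective θ ∧ NonDeg τ ∧ σ = pull θ τ := by
  obtain ⟨m, f, hf, ⟨τ, hτ⟩, h⟩ := (nerve J).exists_nonDegenerate (n := n) σ
  exact ⟨m, f.toOrderHom, τ, SimplexCategory.epi_iff_surjective.1 hf, hτ, h⟩

theorem exists_lt_of_not_nonDeg {σ : ComposableArrows J n} (hσ : ¬ NonDeg σ) :
    ∃ (m : ℕ) (θ : Fin (n + 1) →o Fin (m + 1)) (τ : ComposableArrows J m),
      m < n ∧ Function.Surjective θ ∧ NonDeg τ ∧ σ = pull θ τ := by
  obtain ⟨m, θ, τ, hθ, hτ, rfl⟩ := exists_nonDeg σ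
  refine ⟨m, θ, τ, lt_of_le_of_ne (le_of_surjective_orderHom hθ) ?_, hθ, hτ, rfl⟩
  rintro rfl
  obtain rfl := orderHom_eq_id_of_surjective hθ
  exact hσ hτ

/-- Uniqueness in the Eilenberg-Zilber lemma. It takes the form of a transfer principle because `m`
and `m'` are not known to be equal beforehand, so that `θ` and `θ'` cannot be compared directly. -/
theorem nonDeg_unique {m' : ℕ} {θ : Fin (n + 1) →o Fin (m + 1)} {τ : ComposableArrows J m}
    {θ' : Fin (n + 1) →o Fin (m' + 1)} {τ' : ComposableArrows J m'} (hθ : Function.Surjective θ)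
    (hτ : NonDeg τ) (hθ' : Function.Surjective θ') (hτ' : NonDeg τ') (h : pull θ τ = pull θ' τ')
    (P : ∀ m, (Fin (n + 1) →o Fin (m + 1)) → ComposableArrows J m → Prop) (hP : P m θ τ) :
    P m' θ' τ' := by
  have e1 :=
    (SimplexCategory.epi_iff_surjective
      (f := SimplexCategory.Hom.mk (a := .mk n) (b := .mk m) θ)).2 hθ
  have e2 :=
    (SimplexCategory.epi_iff_surjective
      (f := SimplexCategory.Hom.mk (a := .mk n) (b := .mk m') θ')).2 hθ'
  obtain rfl := (nerve J).unique_nonDegenerate_dim (n := n) (pull θ τ)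
    (SimplexCategory.Hom.mk θ) ⟨τ, hτ⟩ rfl (SimplexCategory.Hom.mk θ') ⟨τ', hτ'⟩ h
  have h1 := (nerve J).unique_nonDegenerate_simplex (n := n) (pull θ τ)
    (SimplexCategory.Hom.mk θ) ⟨τ, hτ⟩ rfl (SimplexCategory.Hom.mk θ') ⟨τ', hτ'⟩ h
  have h2 := (nerve J).unique_nonDegenerate_map (n := n) (pull θ τ)
    (SimplexCategory.Hom.mk θ) ⟨τ, hτ⟩ rfl (SimplexCategory.Hom.mk θ') ⟨τ', hτ'⟩ h
  obtain rfl : τ = τ' := congrArg Subtype.val h1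
  obtain rfl : θ = θ' := congrArg SimplexCategory.Hom.toOrderHom h2
  exact hP

/-! ### Action of monotone maps on the values of a diagram -/

variable (F : J ⥤ TopCat.{v})

/-- The map `F(j_{θ(m)}) → F(j_n)` by which a monotone map `θ : [m] → [n]` acts. -/
def push (θ : Fin (m + 1) →o Fin (n + 1)) (σ : ComposableArrows J n) :
    C(F.obj ((pull θ σ).obj (Fin.last m)), F.obj (σ.obj (Fin.last n))) :=
  (F.map (σ.map (homOfLE (Fin.le_last (θ (Fin.last m)))))).hom

theorem push_comp (θ : Fin (m + 1) →o Fin (n + 1)) (η : Fin (l + 1) →o Fin (m + 1))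
    (σ : ComposableArrows J n) (z) :
    push F (θ.comp η) σ z = push F θ σ (push F η (pull θ σ) z) := by
  have h := (congrArg (fun f => F.map f) (σ.map_comp
    (homOfLE (θ.monotone (Fin.le_last (η (Fin.last l)))))
    (homOfLE (Fin.le_last (θ (Fin.last m)))))).trans (F.map_comp _ _)
  exact ConcreteCategory.congr_hom h z

theorem push_id (σ : ComposableArrows J n) (z) : push F OrderHom.id σ z = z := by
  change (F.map (σ.map (𝟙 _))) z = z
  rw [σ.map_id, F.map_id]
  rfl

/-- The inverse of the action of a surjective monotone map. -/
def pushInv {θ : Fin (m + 1) →o Fin (n + 1)} (hθ : Function.Surjective θ)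
    (σ : ComposableArrows J n) :
    C(F.obj (σ.obj (Fin.last n)), F.obj ((pull θ σ).obj (Fin.last m))) :=
  (F.map (σ.map (homOfLE (orderHom_last_of_surjective hθ).ge))).hom

theorem push_pushInv {θ : Fin (m + 1) →o Fin (n + 1)} (hθ : Function.Surjective θ)
    (σ : ComposableArrows J n) (z) : push F θ σ (pushInv F hθ σ z) = z := by
  change (F.map (σ.map (homOfLE (orderHom_last_of_surjective hθ).ge)) ≫
    F.map (σ.map (homOfLE (Fin.le_last (θ (Fin.last m)))))) z = z
  rw [← F.map_comp, ← σ.map_comp]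
  change (F.map (σ.map (𝟙 _))) z = z
  rw [σ.map_id, F.map_id]
  rfl

theorem pushInv_push {θ : Fin (m + 1) →o Fin (n + 1)} (hθ : Function.Surjective θ)
    (σ : ComposableArrows J n) (z) : pushInv F hθ σ (push F θ σ z) = z := by
  change (F.map (σ.map (homOfLE (Fin.le_last (θ (Fin.last m))))) ≫
    F.map (σ.map (homOfLE (orderHom_last_of_surjective hθ).ge))) z = z
  rw [← F.map_comp, ← σ.map_comp]
  change (F.map (σ.map (𝟙 _))) z = z
  rw [σ.map_id, F.map_id]
  rfl

theorem push_injective {θ : Fin (m + 1) →o Fin (n + 1)} (hθ : Function.Surjective θ)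
    (σ : ComposableArrows J n) : Function.Injective (push F θ σ) :=
  Function.LeftInverse.injective (pushInv_push F hθ σ)

end Chains

end SpaceLocalization

namespace SpaceLocalization

/-! ### Maps into homotopy limits -/

section HoLimTopology

variable {J : Type w} [Category.{w'} J] {F G : J ⥤ TopCat.{v}}

/-- The exponential law for the locally compact simplices; it turns continuity into the joint
continuity of the components. -/
theorem HoLim.continuous_iff {Z : Type*} [TopologicalSpace Z] (φ : Z → HoLim F) :
    Continuous φ ↔ ∀ n (σ : ComposableArrows J n),
      Continuous fun p : Z × stdSimplex ℝ (Fin (n + 1)) => (φ p.1).1 n σ p.2 := by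
  constructor
  · intro h n σ
    have h1 : Continuous fun z => (φ z).1 n σ :=
      continuous_pi_iff.1 (continuous_pi_iff.1 (continuous_subtype_val.comp h) n) σ
    exact (h1.comp continuous_fst).eval continuous_snd
  · intro h
    refine Continuous.subtype_mk (continuous_pi fun n => continuous_pi fun σ => ?_) fun z => (φ z).2
    exact ContinuousMap.continuous_of_continuous_uncurry _ (h n σ)

theorem HoLim.continuous_map (α : F ⟶ G) : Continuous (HoLim.map α) := by
  rw [HoLim.continuous_iff]
  intro n σ
  exact (α.app _).hom.continuous.comp ((HoLim.continuous_iff id).1 continuous_id n σ)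

theorem HoLim.ext {x y : HoLim F} (h : ∀ n (σ : ComposableArrows J n) p, x.1 n σ p = y.1 n σ p) :
    x = y :=
  Subtype.ext (funext fun n => funext fun σ => ContinuousMap.ext (h n σ))

end HoLimTopology

/-! ### Construction of families by induction on the dimension of chains -/

section Families

variable {J : Type w} [Category.{w'} J] (F : J ⥤ TopCat.{v}) (K : Type) [TopologicalSpace K]

/-- Families of maps `K × Δⁿ → F(jₙ)` indexed by the chains of length less than `k`. -/
abbrev PFam (k : ℕ) := ∀ n, n < k → ∀ σ : ComposableArrows J n,
  C(K × stdSimplex ℝ (Fin (n + 1)), F.obj (σ.obj (Fin.last n)))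

variable {F K} {k : ℕ}

/-- Compatibility of a family with monotone maps. -/
def PFam.Compat (x : PFam F K k) : Prop :=
  ∀ (m n : ℕ) (hm : m < k) (hn : n < k) (θ : Fin (m + 1) →o Fin (n + 1))
    (σ : ComposableArrows J n) (z : K) (p : stdSimplex ℝ (Fin (m + 1))),
    push F θ σ (x m hm (pull θ σ) (z, p)) = x n hn σ (z, stdSimplex.map θ p)

/-- Extension of a family by one dimension. -/
def PFam.snoc (x : PFam F K k) (val : ∀ σ : ComposableArrows J k,
    C(K × stdSimplex ℝ (Fin (k + 1)), F.obj (σ.obj (Fin.last k)))) : PFam F K (k + 1) :=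
  fun n hn => if h : n < k then x n h else by
    obtain rfl : n = k := by omega
    exact val

theorem PFam.snoc_of_lt (x : PFam F K k) (val : ∀ σ : ComposableArrows J k,
    C(K × stdSimplex ℝ (Fin (k + 1)), F.obj (σ.obj (Fin.last k)))) {n : ℕ} (hn : n < k) :
    x.snoc val n (hn.trans (Nat.lt_succ_self k)) = x n hn := dif_pos hn

theorem PFam.snoc_last (x : PFam F K k) (val : ∀ σ : ComposableArrows J k,
    C(K × stdSimplex ℝ (Fin (k + 1)), F.obj (σ.obj (Fin.last k)))) :
    x.snoc val k (Nat.lt_succ_self k) = val := dif_neg (lt_irrefl k)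

/-- A compatible family determines the values on degenerate chains of the next dimension. -/
theorem PFam.Compat.exists_degenerate {x : PFam F K k} (hx : x.Compat)
    (σ : ComposableArrows J k) (hσ : ¬ NonDeg σ) :
    ∃ g : C(K × stdSimplex ℝ (Fin (k + 1)), F.obj (σ.obj (Fin.last k))),
      ∀ (m : ℕ) (hm : m < k) (θ : Fin (k + 1) →o Fin (m + 1)) (τ : ComposableArrows J m),
        Function.Surjective θ → ∀ (e : σ = pull θ τ) (z : K) (p : stdSimplex ℝ (Fin (k + 1))),
        push F θ τ (F.map (eqToHom (congrArg (fun ρ => ρ.obj (Fin.last k)) e)) (g (z, p))) =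
          x m hm τ (z, stdSimplex.map θ p) := by
  obtain ⟨m₀, θ₀, τ₀, hm₀, hθ₀, hτ₀, rfl⟩ := exists_lt_of_not_nonDeg hσ
  refine ⟨⟨fun q => pushInv F hθ₀ τ₀ (x m₀ hm₀ τ₀ (q.1, stdSimplex.map θ₀ q.2)),
    (pushInv F hθ₀ τ₀).continuous.comp ((x m₀ hm₀ τ₀).continuous.comp
      (continuous_fst.prodMk ((stdSimplex.continuous_map θ₀).comp continuous_snd)))⟩, ?_⟩
  intro m hm θ τ hθ e z p
  -- The value was defined by a chosen nondegenerate core `τ₀` of the chain. Replacing `τ` by its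
  -- own nondegenerate core makes the uniqueness of that core applicable.
  obtain ⟨m₁, η, τ₁, hη, hτ₁, rfl⟩ := exists_nonDeg τ
  have hm₁ : m₁ < k := (le_of_surjective_orderHom hη).trans_lt hm
  have hηθ : Function.Surjective (η.comp θ) := hη.comp hθ
  refine nonDeg_unique (θ := η.comp θ) (τ := τ₁) (θ' := θ₀) (τ' := τ₀) hηθ hτ₁ hθ₀ hτ₀ e.symm
    (fun m₀ θ₀ τ₀ => ∀ (hm₀ : m₀ < k) (hθ₀ : Function.Surjective θ₀)
      (e : pull θ₀ τ₀ = pull θ (pull η τ₁)),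
      push F θ (pull η τ₁) (F.map (eqToHom (congrArg (fun ρ => ρ.obj (Fin.last k)) e))
        (pushInv F hθ₀ τ₀ (x m₀ hm₀ τ₀ (z, stdSimplex.map θ₀ p)))) =
          x m hm (pull η τ₁) (z, stdSimplex.map θ p)) ?_ hm₀ hθ₀ e
  intro _ h1 e'
  apply push_injective F hη τ₁
  rw [hx m m₁ hm hm₁ η τ₁, stdSimplex.map_comp_apply]
  have hid : ∀ y, F.map (eqToHom (congrArg (fun ρ => ρ.obj (Fin.last k)) e')) y = y := fun y => by
    change (F.map (𝟙 _)) y = y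
    rw [F.map_id]; rfl
  refine (push_comp F η θ τ₁ _).symm.trans ?_
  exact (congrArg (push F (η.comp θ) τ₁) (hid _)).trans (push_pushInv F h1 τ₁ _)

/-- Extension of a compatible family by given values on the nondegenerate chains of the next
dimension. -/
theorem PFam.Compat.exists_extension {x : PFam F K k} (hx : x.Compat)
    (fill : ∀ σ : ComposableArrows J k, NonDeg σ →
      C(K × stdSimplex ℝ (Fin (k + 1)), F.obj (σ.obj (Fin.last k))))
    (hfill : ∀ (σ : ComposableArrows J k) (hσ : NonDeg σ) (l : ℕ) (hl : l < k)
      (θ : Fin (l + 1) →o Fin (k + 1)), Function.Injective θ → ∀ (z : K)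
      (q : stdSimplex ℝ (Fin (l + 1))),
      push F θ σ (x l hl (pull θ σ) (z, q)) = fill σ hσ (z, stdSimplex.map θ q)) :
    ∃ y : PFam F K (k + 1), y.Compat ∧
      (∀ n (hn : n < k), y n (hn.trans (Nat.lt_succ_self k)) = x n hn) ∧
      ∀ σ hσ, y k (Nat.lt_succ_self k) σ = fill σ hσ := by
  classical
  choose d hd using hx.exists_degenerate
  let val : ∀ σ : ComposableArrows J k,
      C(K × stdSimplex ℝ (Fin (k + 1)), F.obj (σ.obj (Fin.last k))) :=
    fun σ => if h : NonDeg σ then fill σ h else d σ h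
  let y := x.snoc val
  have hlt : ∀ {n : ℕ} (hn : n < k) (hn' : n < k + 1), y n hn' = x n hn :=
    fun hn _ => x.snoc_of_lt val hn
  have hk : y k (Nat.lt_succ_self k) = val := x.snoc_last val
  have val_nd : ∀ σ (h : NonDeg σ), val σ = fill σ h := fun σ h => dif_pos h
  have val_d : ∀ σ (h : ¬ NonDeg σ), val σ = d σ h := fun σ h => dif_neg h
  -- surjections onto chains of smaller dimension
  have hsurj : ∀ (l : ℕ) (hl : l < k) (ε : Fin (k + 1) →o Fin (l + 1)) (σ : ComposableArrows J l)
      (z : K) (p : stdSimplex ℝ (Fin (k + 1))), Function.Surjective ε →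
      push F ε σ (val (pull ε σ) (z, p)) = x l hl σ (z, stdSimplex.map ε p) := by
    intro l hl ε σ z p hε
    rw [val_d _ (not_nonDeg_pull hl ε σ)]
    have := hd (pull ε σ) (not_nonDeg_pull hl ε σ) l hl ε σ hε rfl z p
    rw [eqToHom_refl, F.map_id] at this
    exact this
  -- arbitrary maps to chains of smaller dimension
  have hlow : ∀ (m l : ℕ) (hm : m < k + 1) (hl : l < k) (θ : Fin (m + 1) →o Fin (l + 1))
      (σ : ComposableArrows J l) (z : K) (p : stdSimplex ℝ (Fin (m + 1))),
      push F θ σ (y m hm (pull θ σ) (z, p)) = x l hl σ (z, stdSimplex.map θ p) := by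
    intro m l hm hl θ σ z p
    rcases Nat.lt_succ_iff_lt_or_eq.1 hm with hm' | rfl
    · rw [hlt hm']
      exact hx _ _ _ _ _ _ _ _
    · rw [hk]
      obtain ⟨r, ε, δ, hε, hδ, rfl⟩ := exists_factorization θ
      have hr : r < m := (le_of_injective_orderHom hδ).trans_lt hl
      rw [push_comp]
      refine (congrArg (push F δ σ) (hsurj r hr ε (pull δ σ) z p hε)).trans ?_
      rw [hx r l hr hl δ σ, stdSimplex.map_comp_apply]
      rfl
  refine ⟨y, ?_, fun n hn => hlt hn _, fun σ hσ => by rw [hk, val_nd]⟩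
  intro m n hm hn θ σ z p
  rcases Nat.lt_succ_iff_lt_or_eq.1 hn with hn' | rfl
  · rw [hlt hn']
    exact hlow m n hm hn' θ σ z p
  · rw [hk]
    -- Over a nondegenerate chain of the top dimension, a surjection from dimension at most `k` is
    -- the identity, and any other map factors through a proper face, where `hfill` applies.
    by_cases hσ : NonDeg σ
    · rw [val_nd σ hσ]
      by_cases hθ : Function.Surjective θ
      · obtain rfl : m = n := le_antisymm (Nat.lt_succ_iff.1 hm) (le_of_surjective_orderHom hθ)
        obtain rfl := orderHom_eq_id_of_surjective hθ
        rw [push_id, hk]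
        have h1 : stdSimplex.map (S := ℝ) (OrderHom.id : Fin (m + 1) →o Fin (m + 1)) p = p :=
          stdSimplex.map_id_apply p
        rw [h1]
        exact congrArg (fun g : C(K × stdSimplex ℝ (Fin (m + 1)), F.obj (σ.obj (Fin.last m))) =>
          g (z, p)) (val_nd σ hσ)
      · obtain ⟨r, ε, δ, hε, hδ, rfl⟩ := exists_factorization θ
        have hδ' : ¬ Function.Surjective δ := fun h => hθ (h.comp hε)
        have hr := lt_of_injective_orderHom hδ hδ'
        rw [push_comp]
        refine (congrArg (push F δ σ) (hlow m r hm hr ε (pull δ σ) z p)).trans ?_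
        rw [hfill σ hσ r hr δ hδ, stdSimplex.map_comp_apply]
        rfl
    · obtain ⟨l, f, τ, hl, hf, hτ, rfl⟩ := exists_lt_of_not_nonDeg hσ
      -- A degenerate chain comes from a chain `τ` of smaller dimension by a surjection, whose
      -- action is injective; the compatibility may be tested over `τ`.
      apply push_injective F hf τ
      rw [hsurj l hl f τ z _ hf, stdSimplex.map_comp_apply]
      exact (push_comp F f θ τ _).symm.trans (hlow m l hm hl (f.comp θ) τ z p)

/-- Construction of a family on all chains, subject to a condition `P` that passes to degenerate
chains, by extension from the boundary of nondegenerate chains. -/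
theorem exists_family (P : ∀ (n : ℕ) (σ : ComposableArrows J n),
      C(K × stdSimplex ℝ (Fin (n + 1)), F.obj (σ.obj (Fin.last n))) → Prop)
    (hdeg : ∀ (m n : ℕ) (θ : Fin (m + 1) →o Fin (n + 1)) (σ : ComposableArrows J n) (g h),
      Function.Surjective θ → P n σ h →
      (∀ z p, push F θ σ (g (z, p)) = h (z, stdSimplex.map θ p)) → P m (pull θ σ) g)
    (hfill : ∀ (k : ℕ) (σ : ComposableArrows J k), NonDeg σ → ∀ x : PFam F K k, x.Compat →
      (∀ n hn σ, P n σ (x n hn σ)) → ∃ g, P k σ g ∧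
        ∀ (l : ℕ) (hl : l < k) (θ : Fin (l + 1) →o Fin (k + 1)), Function.Injective θ → ∀ z q,
          push F θ σ (x l hl (pull θ σ) (z, q)) = g (z, stdSimplex.map θ q)) :
    ∃ x : ∀ (n : ℕ) (σ : ComposableArrows J n),
      C(K × stdSimplex ℝ (Fin (n + 1)), F.obj (σ.obj (Fin.last n))),
      (∀ n σ, P n σ (x n σ)) ∧
      ∀ (m n : ℕ) (θ : Fin (m + 1) →o Fin (n + 1)) (σ : ComposableArrows J n) (z : K)
        (p : stdSimplex ℝ (Fin (m + 1))),
        push F θ σ (x m (pull θ σ) (z, p)) = x n σ (z, stdSimplex.map θ p) := by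
  let S (k : ℕ) := {x : PFam F K k // x.Compat ∧ ∀ n hn σ, P n σ (x n hn σ)}
  have step : ∀ (k : ℕ) (x : S k), ∃ y : S (k + 1),
      ∀ n (hn : n < k), y.1 n (hn.trans (Nat.lt_succ_self k)) = x.1 n hn := by
    rintro k ⟨x, hx, hP⟩
    choose fill hfP hf using fun σ hσ => hfill k σ hσ x hx hP
    obtain ⟨y, hy, hyx, hyf⟩ := hx.exists_extension fill hf
    have hlow : ∀ n (hn : n < k) σ, P n σ (y n (hn.trans (Nat.lt_succ_self k)) σ) := by
      intro n hn σ
      rw [hyx n hn]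
      exact hP n hn σ
    refine ⟨⟨y, hy, fun n hn σ => ?_⟩, hyx⟩
    rcases Nat.lt_succ_iff_lt_or_eq.1 hn with hn' | rfl
    · exact hlow n hn' σ
    · by_cases hσ : NonDeg σ
      · rw [hyf σ hσ]
        exact hfP σ hσ
      · obtain ⟨l, f, τ, hl, hf, hτ, rfl⟩ := exists_lt_of_not_nonDeg hσ
        exact hdeg _ _ f τ _ _ hf (hlow l hl τ) fun z p => hy _ _ _ _ f τ z p
  choose next hnext using step
  let X : ∀ k, S k := fun k => Nat.rec ⟨fun n hn => absurd hn n.not_lt_zero,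
    fun m n hm => absurd hm m.not_lt_zero, fun n hn => absurd hn n.not_lt_zero⟩ next k
  have hX : ∀ k, X (k + 1) = next k (X k) := fun k => rfl
  -- Each stage extends the previous one, so the values in dimension `n` are those of stage `n + 1`.
  -- Compatibility between dimensions `m` and `n` is then read off at the common stage `max m n +
  -- 1`.
  have stable : ∀ n k (hn : n < k), (X k).1 n hn = (X (n + 1)).1 n (Nat.lt_succ_self n) := by
    intro n k hn
    induction k with
    | zero => exact absurd hn n.not_lt_zero
    | succ k ih =>
      rcases Nat.lt_succ_iff_lt_or_eq.1 hn with hn' | rfl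
      · rw [hX, hnext k (X k) n hn']
        exact ih hn'
      · rfl
  refine ⟨fun n => (X (n + 1)).1 n (Nat.lt_succ_self n), fun n σ => (X (n + 1)).2.2 _ _ _, ?_⟩
  intro m n θ σ z p
  have hm : m < max m n + 1 := by omega
  have hn : n < max m n + 1 := by omega
  have h1 := congrFun (stable m _ hm) (pull θ σ)
  have h2 := congrFun (stable n _ hn) σ
  exact (congrArg (fun g => push F θ σ (g (z, p))) h1).symm.trans
    (((X (max m n + 1)).2.1 m n hm hn θ σ z p).trans
      (congrArg (fun g => g (z, stdSimplex.map θ p)) h2))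

end Families

/-! ### Homotopy invariance of homotopy limits -/

section HomotopyInvariance

/-- The right lifting property with respect to all cells and their boundaries. -/
def HasCellRLP {X : Type u} {Y : Type v} [TopologicalSpace X] [TopologicalSpace Y]
    (f : C(X, Y)) : Prop :=
  ∀ (n : ℕ) (K : Type) [TopologicalSpace K] (L : Set K), IsCell n K L →
    ∀ (u : C(L, X)) (v : C(K, Y)), (∀ x : L, f (u x) = v x) →
      ∃ w : C(K, X), (∀ x : L, w x = u x) ∧ ∀ x, f (w x) = v x

variable {J : Type w} [Category.{w'} J] {F G : J ⥤ TopCat.{v}}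

/-- A compatible family on the faces of a chain glues to a map on the boundary of the product
of a cell and a simplex. -/
theorem exists_glue_boundary {r k : ℕ} {K : Type} [TopologicalSpace K] {L : Set K}
    (hK : IsCell r K L) (σ : ComposableArrows J k) {x : PFam F K k} (hx : x.Compat)
    (u : C(L, HoLim F)) (hu : ∀ n hn τ (z : L) p, x n hn τ ((z : K), p) = (u z).1 n τ p) :
    ∃ g : C(prodBd L (simplexBd k), F.obj (σ.obj (Fin.last k))),
      (∀ (z : L) p, g ⟨((z : K), p), Or.inl z.2⟩ = (u z).1 k σ p) ∧
      ∀ (l : ℕ) (hl : l < k) (θ : Fin (l + 1) →o Fin (k + 1)), Function.Injective θ →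
        ∀ (z : K) q (h : ((z, stdSimplex.map θ q) : K × _) ∈ prodBd L (simplexBd k)),
        g ⟨(z, stdSimplex.map θ q), h⟩ = push F θ σ (x l hl (pull θ σ) (z, q)) := by
  have := hK.compactSpace
  have := hK.t2Space
  have := hK.compactSpace_bd
  let Idx := Σ l : Fin k, {θ : Fin (l + 1) →o Fin (k + 1) // Function.Injective θ}
  have : ∀ l : Fin k, Finite {θ : Fin (l + 1) →o Fin (k + 1) // Function.Injective θ} := fun l =>
    Finite.of_injective (fun θ => (θ.1 : Fin (l + 1) → Fin (k + 1))) fun a b h =>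
      Subtype.ext (OrderHom.ext _ _ h)
  have hfin : Finite Idx := inferInstance
  have hbd : ∀ (i : Idx) q, stdSimplex.map i.2.1 q ∈ simplexBd k := by
    rintro ⟨l, θ, hθ⟩ q
    have hs : ¬ Function.Surjective θ := fun h => by
      have := le_of_surjective_orderHom h
      have := l.2
      omega
    rw [Function.Surjective, not_forall] at hs
    obtain ⟨i, hi⟩ := hs
    refine ⟨i, ?_⟩
    by_contra h
    exact hi (exists_of_stdSimplex_map_ne_zero h)
  -- The boundary is a quotient of the disjoint union of the pieces `K × Δˡ`, one for each proper
  -- face, and `L × Δᵏ`. As there are finitely many faces, this union is compact and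
  -- `exists_descend` applies.
  let Q := (Σ i : Idx, K × stdSimplex ℝ (Fin (i.1 + 1))) ⊕ L × stdSimplex ℝ (Fin (k + 1))
  let q : C(Q, prodBd L (simplexBd k)) :=
    ⟨Sum.elim (fun p => ⟨(p.2.1, stdSimplex.map p.1.2.1 p.2.2), Or.inr (hbd _ _)⟩)
      (fun p => ⟨(p.1, p.2), Or.inl p.1.2⟩), by
      refine continuous_sumElim.2 ⟨continuous_sigma fun i => ?_, by fun_prop⟩
      exact Continuous.subtype_mk (continuous_fst.prodMk
        ((stdSimplex.continuous_map i.2.1).comp continuous_snd)) _⟩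
  let g : C(Q, F.obj (σ.obj (Fin.last k))) :=
    ⟨Sum.elim (fun p => push F p.1.2.1 σ (x p.1.1 p.1.1.2 (pull p.1.2.1 σ) p.2))
      (fun p => (u p.1).1 k σ p.2), by
      refine continuous_sumElim.2 ⟨continuous_sigma fun i => ?_, ?_⟩
      · exact (push F i.2.1 σ).continuous.comp (x i.1 i.1.2 (pull i.2.1 σ)).continuous
      · exact (HoLim.continuous_iff u).1 u.continuous k σ⟩
  have hq : Function.Surjective q := by
    rintro ⟨⟨z, p⟩, h⟩
    by_cases hz : z ∈ L
    · exact ⟨Sum.inr (⟨z, hz⟩, p), rfl⟩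
    · obtain ⟨i, hi⟩ : p ∈ simplexBd k := h.resolve_left hz
      obtain ⟨r, ζ, s, hζ, rfl, hne⟩ := exists_face p
      have hs : ¬ Function.Surjective ζ := fun h => by
        obtain ⟨j, rfl⟩ := h i
        exact hne j hi
      exact ⟨Sum.inl ⟨⟨⟨r, lt_of_injective_orderHom hζ hs⟩, ζ, hζ⟩, (z, s)⟩, rfl⟩
  have hmix : ∀ (i : Idx) (z : L) (q : stdSimplex ℝ (Fin (i.1 + 1))),
      push F i.2.1 σ (x i.1 i.1.2 (pull i.2.1 σ) ((z : K), q)) =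
        (u z).1 k σ (stdSimplex.map i.2.1 q) := fun i z q => by
    rw [hu]
    exact (u z).2 i.1 k i.2.1 σ q
  obtain ⟨g', hg'⟩ := exists_descend q hq g (by
    rintro (⟨i, z, p⟩ | ⟨z, p⟩) (⟨i', z', p'⟩ | ⟨z', p'⟩) h
    · obtain ⟨rfl, hp⟩ : z = z' ∧ stdSimplex.map i.2.1 p = stdSimplex.map i'.2.1 p' :=
        Prod.mk.inj (congrArg Subtype.val h)
      -- Two faces meet in common subfaces, on which both values are determined by the compatibility
      -- of `x`.
      obtain ⟨r, η, η', s, hr, he, rfl, rfl⟩ := exists_common_face i.2.2 i'.2.2 hp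
      have hrk : r < k := hr.trans_lt i.1.2
      have face : ∀ (j : Idx) (ξ : Fin (r + 1) →o Fin (j.1 + 1)),
          push F j.2.1 σ (x j.1 j.1.2 (pull j.2.1 σ) (z, stdSimplex.map ξ s)) =
            push F (j.2.1.comp ξ) σ (x r hrk (pull (j.2.1.comp ξ) σ) (z, s)) := fun j ξ => by
        rw [push_comp, ← hx r j.1 hrk j.1.2 ξ (pull j.2.1 σ) z s]
        rfl
      refine (face i η).trans (Eq.trans ?_ (face i' η').symm)
      rw [he]
    · obtain ⟨rfl, rfl⟩ : z = z' ∧ stdSimplex.map i.2.1 p = p' :=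
        Prod.mk.inj (congrArg Subtype.val h)
      exact hmix i z' p
    · obtain ⟨rfl, rfl⟩ : z = z' ∧ p = stdSimplex.map i'.2.1 p' :=
        Prod.mk.inj (congrArg Subtype.val h)
      exact (hmix i' z p').symm
    · obtain ⟨hz, rfl⟩ : (z : K) = z' ∧ p = p' := Prod.mk.inj (congrArg Subtype.val h)
      obtain rfl := Subtype.ext hz
      rfl)
  exact ⟨g', fun z p => hg' (Sum.inr (z, p)), fun l hl θ hθ z p _ =>
    hg' (Sum.inl ⟨⟨⟨l, hl⟩, θ, hθ⟩, (z, p)⟩)⟩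

theorem push_natural (α : F ⟶ G) {m n : ℕ} (θ : Fin (m + 1) →o Fin (n + 1))
    (σ : ComposableArrows J n) (z) :
    α.app _ (push F θ σ z) = push G θ σ (α.app _ z) :=
  ConcreteCategory.congr_hom (α.naturality (σ.map (homOfLE (Fin.le_last (θ (Fin.last m)))))) z

/-- A lift is a compatible family of maps `K × Δⁿ → F(jₙ)` over `v` that extends `u`. On a
nondegenerate `k`-chain, `u` and the shorter chains prescribe it on the boundary of the cell `K ×
Δᵏ`, and the lifting property of the component of `α` at the last object fills it. -/
theorem HasCellRLP.hoLimMap {α : F ⟶ G} (h : ∀ j, HasCellRLP (α.app j).hom) :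
    HasCellRLP (⟨HoLim.map α, HoLim.continuous_map α⟩ : C(HoLim F, HoLim G)) := by
  intro r K _ L hK u v huv
  have huv' : ∀ (z : L) n (σ : ComposableArrows J n) p,
      α.app _ ((u z).1 n σ p) = (v z).1 n σ p := fun z n σ p =>
    congrArg (fun y : HoLim G => y.1 n σ p) (huv z)
  obtain ⟨x, hxP, hx⟩ := exists_family (F := F) (K := K)
    (fun n σ g => (∀ z p, α.app _ (g (z, p)) = (v z).1 n σ p) ∧
      ∀ (z : L) p, g ((z : K), p) = (u z).1 n σ p)
    (by
      rintro m n θ σ g g' hθ ⟨h1, h2⟩ hg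
      refine ⟨fun z p => ?_, fun z p => ?_⟩
      · apply push_injective G hθ σ
        rw [← push_natural, hg, h1]
        exact ((v z).2 m n θ σ p).symm
      · apply push_injective F hθ σ
        rw [hg, h2]
        exact ((u z).2 m n θ σ p).symm)
    (by
      intro k σ _ x hx hP
      obtain ⟨g, hg1, hg2⟩ := exists_glue_boundary hK σ hx u fun n hn τ z p => (hP n hn τ).2 z p
      obtain ⟨y, hy1, hy2⟩ := h _ _ _ _ (hK.prod (isCell_stdSimplex k)) g
        ⟨fun p => (v p.1).1 k σ p.2, (HoLim.continuous_iff v).1 v.continuous k σ⟩ (by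
          rintro ⟨⟨z, p⟩, hzp⟩
          by_cases hz : z ∈ L
          · exact (congrArg (α.app _) (hg1 ⟨z, hz⟩ p)).trans (huv' ⟨z, hz⟩ k σ p)
          · obtain ⟨i, hi⟩ : p ∈ simplexBd k := hzp.resolve_left hz
            obtain ⟨r, ζ, s, hζ, rfl, hne⟩ := exists_face p
            have hs : ¬ Function.Surjective ζ := fun h => by
              obtain ⟨j, rfl⟩ := h i
              exact hne j hi
            have hr := lt_of_injective_orderHom hζ hs
            refine (congrArg (α.app _) (hg2 r hr ζ hζ z s hzp)).trans ?_
            rw [push_natural, (hP r hr (pull ζ σ)).1]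
            exact (v z).2 r k ζ σ s)
      refine ⟨y, ⟨fun z p => hy2 (z, p), fun z p => (hy1 ⟨((z : K), p), Or.inl z.2⟩).trans
        (hg1 z p)⟩, fun l hl θ hθ z q => ?_⟩
      have hb : (z, stdSimplex.map θ q) ∈ prodBd L (simplexBd k) := by
        have hs : ¬ Function.Surjective θ := fun h => by
          have := le_of_surjective_orderHom h
          omega
        rw [Function.Surjective, not_forall] at hs
        obtain ⟨i, hi⟩ := hs
        exact Or.inr ⟨i, by_contra fun h => hi (exists_of_stdSimplex_map_ne_zero h)⟩
      exact ((hy1 ⟨_, hb⟩).trans (hg2 l hl θ hθ z q hb)).symm)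
  let w : K → HoLim F := fun z => ⟨fun n σ => (x n σ).comp ⟨fun p => (z, p), by fun_prop⟩,
    fun m n θ σ p => hx m n θ σ z p⟩
  have hw : Continuous w := (HoLim.continuous_iff w).2 fun n σ => (x n σ).continuous
  exact ⟨⟨w, hw⟩, fun z => HoLim.ext fun n σ p => (hxP n σ).2 z p,
    fun z => HoLim.ext fun n σ p => (hxP n σ).1 z p⟩

/-- The mapping path space of a map of diagrams. -/
def pathDiagram (α : F ⟶ G) : J ⥤ TopCat.{v} where
  obj j := TopCat.of {z : F.obj j × C(unitInterval, G.obj j) // z.2 0 = α.app j z.1}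
  map {i j} f := TopCat.ofHom ⟨fun z => ⟨(F.map f z.1.1, (G.map f).hom.comp z.1.2), by
      refine (congrArg (G.map f) z.2).trans ?_
      exact (ConcreteCategory.congr_hom (α.naturality f) z.1.1).symm⟩, by
      refine Continuous.subtype_mk (Continuous.prodMk ?_ ?_) _
      · exact (F.map f).hom.continuous.comp (continuous_fst.comp continuous_subtype_val)
      · exact (ContinuousMap.continuous_postcomp _).comp
          (continuous_snd.comp continuous_subtype_val)⟩
  map_id j := by
    refine TopCat.hom_ext (ContinuousMap.ext fun z => Subtype.ext
      (Prod.ext ?_ (ContinuousMap.ext fun t => ?_)))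
    · change F.map (𝟙 j) z.1.1 = z.1.1
      rw [F.map_id]; rfl
    · change G.map (𝟙 j) (z.1.2 t) = z.1.2 t
      rw [G.map_id]; rfl
  map_comp f g := by
    refine TopCat.hom_ext (ContinuousMap.ext fun z => Subtype.ext
      (Prod.ext ?_ (ContinuousMap.ext fun t => ?_)))
    · change F.map (f ≫ g) z.1.1 = F.map g (F.map f z.1.1)
      rw [F.map_comp]; rfl
    · change G.map (f ≫ g) (z.1.2 t) = G.map g (G.map f (z.1.2 t))
      rw [G.map_comp]; rfl

/-- The inclusion of constant paths. -/
def pathDiagramIncl (α : F ⟶ G) : F ⟶ pathDiagram α where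
  app j := TopCat.ofHom ⟨fun x => ⟨(x, ContinuousMap.const _ (α.app j x)), rfl⟩, by
    refine Continuous.subtype_mk (continuous_id.prodMk ?_) _
    exact ContinuousMap.continuous_const'.comp (α.app j).hom.continuous⟩
  naturality i j f := by
    refine TopCat.hom_ext (ContinuousMap.ext fun x => Subtype.ext
      (Prod.ext rfl (ContinuousMap.ext fun t => ?_)))
    exact ConcreteCategory.congr_hom (α.naturality f) x

/-- The projection of the mapping path space to the source. -/
def pathDiagramFst (α : F ⟶ G) : pathDiagram α ⟶ F where
  app j := TopCat.ofHom ⟨fun z => z.1.1, continuous_fst.comp continuous_subtype_val⟩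

/-- Evaluation of paths. -/
def pathDiagramEval (α : F ⟶ G) (t : unitInterval) : pathDiagram α ⟶ G where
  app j := TopCat.ofHom ⟨fun z => z.1.2 t,
    (continuous_eval_const t).comp (continuous_snd.comp continuous_subtype_val)⟩

/-- A lift to the mapping path space is a map `w` to the source together with a homotopy from `α ∘
w` to `v`, prescribed over `L`. This is the content of `RelLift.exists_transp`: the path coordinate
absorbs the homotopy, which makes the lifting strict. -/
theorem hasCellRLP_pathDiagramEval {α : F ⟶ G} {j : J} (h : IsWeakEquiv (α.app j)) :
    HasCellRLP ((pathDiagramEval α 1).app j).hom := by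
  intro n K _ L hK u v huv
  have hf : RelLift (α.app j).hom := h.relLift
  let Γ : C(unitInterval × L, G.obj j) := ⟨fun p => (u p.2).1.2 p.1,
    ((continuous_snd.comp (continuous_subtype_val.comp (u.continuous.comp continuous_snd))).eval
      continuous_fst)⟩
  let u₀ : C(L, F.obj j) := ⟨fun l => (u l).1.1,
    continuous_fst.comp (continuous_subtype_val.comp u.continuous)⟩
  obtain ⟨w, hw, H, h0, h1, h2⟩ := hf.exists_transp hK u₀ v Γ (fun l => (u l).2) huv
  refine ⟨⟨fun z => ⟨(w z, H.comp ⟨fun t => (t, z), by fun_prop⟩), h0 z⟩, ?_⟩, fun l => ?_, h1⟩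
  · refine Continuous.subtype_mk (w.continuous.prodMk ?_) _
    refine ContinuousMap.continuous_of_continuous_uncurry _ ?_
    exact H.continuous.comp continuous_swap
  · apply Subtype.ext
    exact Prod.ext (hw l) (ContinuousMap.ext fun t => h2 t l)

/-- Homotopy limits preserve objectwise weak equivalences. -/
theorem isWeakEquiv_hoLimMap {α : F ⟶ G} (h : ∀ j, IsWeakEquiv (α.app j)) :
    IsWeakEquiv (HoLim.map α) := by
  suffices RelLift (⟨HoLim.map α, HoLim.continuous_map α⟩ : C(HoLim F, HoLim G)) from
    this.isWeakEquiv
  intro n K _ L hK u v huv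
  -- The boundary lift `u` is viewed as a family of constant paths.
  obtain ⟨w, hw, hwv⟩ := HasCellRLP.hoLimMap
    (fun j => hasCellRLP_pathDiagramEval (h j)) n K L hK
    ((⟨_, HoLim.continuous_map (pathDiagramIncl α)⟩ : C(HoLim F, HoLim (pathDiagram α))).comp u) v
    huv
  refine ⟨(⟨_, HoLim.continuous_map (pathDiagramFst α)⟩ :
    C(HoLim (pathDiagram α), HoLim F)).comp w, fun l => ?_, ?_⟩
  · exact congrArg (HoLim.map (pathDiagramFst α)) (hw l)
  -- Evaluation at time `t` deforms the image of the source coordinate into `v`; it is stationary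
  -- over `L`, where the paths are constant.
  · refine homotopicRel_iff.2 ⟨⟨fun p => HoLim.map (pathDiagramEval α p.1) (w p.2), ?_⟩,
      fun z => ?_, hwv, fun t z hz => ?_⟩
    · rw [HoLim.continuous_iff]
      intro n σ
      have h1 : Continuous fun p : (unitInterval × K) × stdSimplex ℝ (Fin (n + 1)) =>
          (w p.1.2).1 n σ p.2 :=
        ((HoLim.continuous_iff w).1 w.continuous n σ).comp
          ((continuous_snd.comp continuous_fst).prodMk continuous_snd)
      exact (continuous_snd.comp (continuous_subtype_val.comp h1)).eval
        (continuous_fst.comp continuous_fst)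
    · exact HoLim.ext fun n σ p => ((w z).1 n σ p).2
    · change HoLim.map (pathDiagramEval α t) (w z) =
        HoLim.map α (HoLim.map (pathDiagramFst α) (w z))
      rw [hw ⟨z, hz⟩]
      rfl

end HomotopyInvariance

end SpaceLocalization

namespace SpaceLocalization

/-! ### Homotopy limits of cospans -/

section Cospan

variable {J : Type w} [Category.{w'} J] {F : J ⥤ TopCat.{v}}

theorem stdSimplex_map_const {m n : ℕ} {θ : Fin (m + 1) → Fin (n + 1)} {c : Fin (n + 1)}
    (h : ∀ i, θ i = c) (p : stdSimplex ℝ (Fin (m + 1))) :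
    stdSimplex.map θ p = stdSimplex.vertex c := by
  ext i
  rw [stdSimplex_map_apply, stdSimplex.vertex_coe]
  by_cases hi : i = c
  · subst hi
    rw [Pi.single_eq_same, Finset.filter_true_of_mem fun j _ => h j, stdSimplex.sum_eq_one]
  · rw [Pi.single_eq_of_ne hi, Finset.filter_false_of_mem, Finset.sum_empty]
    intro j _ hj
    exact hi (hj.symm.trans (h j))

theorem HoLim.continuous_proj (j : J) : Continuous fun y : HoLim F => y.proj j :=
  ((HoLim.continuous_iff id).1 continuous_id 0 (ComposableArrows.mk₀ j)).comp
    (continuous_id.prodMk continuous_const)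

/-- Once such a chain leaves its first object it stays at `o`. -/
theorem chain_eq_zero {o : J} (ho : ∀ {i j : J}, (i ⟶ j) → j = i ∨ j = o) {n : ℕ}
    (σ : ComposableArrows J n) {i j : Fin (n + 1)} (hij : i ≤ j) (h : σ.obj j = σ.obj 0) :
    σ.obj i = σ.obj 0 := by
  rcases ho (σ.map (homOfLE (Fin.zero_le i))) with h1 | h1
  · exact h1
  · rcases ho (σ.map (homOfLE hij)) with h2 | h2
    · rw [← h2, h]
    · rw [h1, ← h2, h]

open Classical in
/-- In a chain `j → ⋯ → j → o → ⋯ → o`, the vertices are those with object `j` and those with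
object `o`. -/
def chainSplit {o : J} (ho : ∀ {i j : J}, (i ⟶ j) → j = i ∨ j = o) {n : ℕ}
    (σ : ComposableArrows J n) : Fin (n + 1) →o Fin (1 + 1) where
  toFun i := if σ.obj i = σ.obj 0 then 0 else 1
  monotone' i j hij := by
    by_cases hj : σ.obj j = σ.obj 0
    · simp [hj, chain_eq_zero ho σ hij hj]
    · simp only [hj, if_false]
      exact Fin.le_last _

theorem chainSplit_of_eq {o : J} (ho : ∀ {i j : J}, (i ⟶ j) → j = i ∨ j = o) {n : ℕ}
    (σ : ComposableArrows J n) {i : Fin (n + 1)} (h : σ.obj i = σ.obj 0) :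
    chainSplit ho σ i = 0 := if_pos h

theorem chainSplit_of_ne {o : J} (ho : ∀ {i j : J}, (i ⟶ j) → j = i ∨ j = o) {n : ℕ}
    (σ : ComposableArrows J n) {i : Fin (n + 1)} (h : σ.obj i ≠ σ.obj 0) :
    chainSplit ho σ i = 1 := if_neg h

/-- The composition of a chain. -/
abbrev chainHom {n : ℕ} (σ : ComposableArrows J n) : σ.obj 0 ⟶ σ.obj (Fin.last n) :=
  σ.map (homOfLE (Fin.zero_le _))

variable [Quiver.IsThin J]

theorem map_self_apply {i : J} (f : i ⟶ i) (z : F.obj i) : F.map f z = z := by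
  rw [Subsingleton.elim f (𝟙 i), F.map_id]
  rfl

theorem map_map_self_apply {i j : J} (f : i ⟶ j) (g : j ⟶ i) (z : F.obj i) :
    F.map g (F.map f z) = z :=
  (ConcreteCategory.congr_hom (F.map_comp f g) z).symm.trans (map_self_apply (f ≫ g) z)

/-- A map to the homotopy limit, given by values at the objects and at the morphisms. -/
theorem exists_hoLim_of_edges {o : J} (ho : ∀ {i j : J}, (i ⟶ j) → j = i ∨ j = o) {K : Type}
    [TopologicalSpace K] (x : ∀ j, C(K, F.obj j))
    (e : ∀ {i j : J}, (i ⟶ j) → C(K × stdSimplex ℝ (Fin (1 + 1)), F.obj j))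
    (he₀ : ∀ {i j : J} (f : i ⟶ j) z, e f (z, stdSimplex.vertex 0) = F.map f (x i z))
    (he₁ : ∀ {i j : J} (f : i ⟶ j) z, e f (z, stdSimplex.vertex 1) = x j z)
    (hid : ∀ {i j : J} (f : i ⟶ j), i = j → ∀ z p, e f (z, p) = x j z) :
    ∃ y : C(K, HoLim F), ∀ z n (σ : ComposableArrows J n) p,
      (y z).1 n σ p = e (chainHom σ) (z, stdSimplex.map (chainSplit ho σ) p) := by
  have hx : ∀ {i i' j : J} (_ : i = i') (f : i ⟶ j) (f' : i' ⟶ j) z,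
      F.map f (x i z) = F.map f' (x i' z) := by
    rintro i _ j rfl f f' z
    rw [Subsingleton.elim f f']
  have hx' : ∀ {i j : J} (_ : i = j) (f : i ⟶ j) z, F.map f (x i z) = x j z := by
    rintro i _ rfl f z
    exact map_self_apply f _
  have hee : ∀ {i i' j j' : J} (_ : i = i') (_ : j = j') (f : i ⟶ j) (f' : i' ⟶ j') (g : j ⟶ j')
      (z p), F.map g (e f (z, p)) = e f' (z, p) := by
    rintro i _ j _ rfl rfl f f' g z p
    rw [Subsingleton.elim f f']
    exact map_self_apply g _
  let c : ∀ n (σ : ComposableArrows J n),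
      C(K × stdSimplex ℝ (Fin (n + 1)), F.obj (σ.obj (Fin.last n))) := fun n σ =>
    (e (chainHom σ)).comp ⟨fun q => (q.1, stdSimplex.map (chainSplit ho σ) q.2),
      continuous_fst.prodMk ((stdSimplex.continuous_map _).comp continuous_snd)⟩
  have compat : ∀ (m n : ℕ) (θ : Fin (m + 1) →o Fin (n + 1)) (σ : ComposableArrows J n) (z : K)
      (p : stdSimplex ℝ (Fin (m + 1))),
      F.map (σ.map (homOfLE (Fin.le_last (θ (Fin.last m))))) (c m (pull θ σ) (z, p)) =
        c n σ (z, stdSimplex.map θ p) := by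
    intro m n θ σ z p
    change F.map (σ.map (homOfLE (Fin.le_last (θ (Fin.last m)))))
      (e (chainHom (pull θ σ)) (z, stdSimplex.map (chainSplit ho (pull θ σ)) p)) =
      e (chainHom σ) (z, stdSimplex.map (chainSplit ho σ) (stdSimplex.map θ p))
    rw [stdSimplex.map_comp_apply]
    -- the case where the first and the last object of the subchain agree
    have hconst : ∀ h : σ.obj (θ 0) = σ.obj (θ (Fin.last m)),
        F.map (σ.map (homOfLE (Fin.le_last (θ (Fin.last m)))))
          (e (chainHom (pull θ σ)) (z, stdSimplex.map (chainSplit ho (pull θ σ)) p)) =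
        F.map (σ.map (homOfLE (Fin.le_last (θ (Fin.last m))))) (x _ z) := fun h =>
      congrArg _ (hid (chainHom (pull θ σ)) h z _)
    -- If all objects of `σ` agree, both sides are values of `x`. Otherwise `σ` ends at `o`, and the
    -- subchain lies in the first block (condition `he₀`), meets both blocks (the same edge on both
    -- sides), or lies in the second block (condition `he₁`).
    by_cases hσ : σ.obj (Fin.last n) = σ.obj 0
    · have hall : ∀ i, σ.obj i = σ.obj 0 := fun i => chain_eq_zero ho σ (Fin.le_last i) hσ
      rw [hconst ((hall _).trans (hall _).symm), hid (chainHom σ) hσ.symm]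
      exact hx' ((hall _).trans hσ.symm) _ z
    · have hno : ∀ i, σ.obj i ≠ σ.obj 0 → σ.obj i = o := fun i hi =>
        (ho (σ.map (homOfLE (Fin.zero_le i)))).resolve_left hi
      by_cases h0 : σ.obj (θ 0) = σ.obj 0
      · by_cases h1 : σ.obj (θ (Fin.last m)) = σ.obj 0
        · rw [hconst (h0.trans h1.symm)]
          have hψ : ∀ i, (chainSplit ho σ ∘ θ) i = 0 := fun i =>
            chainSplit_of_eq ho σ (chain_eq_zero ho σ (θ.monotone (Fin.le_last i)) h1)
          rw [stdSimplex_map_const hψ, he₀]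
          exact hx h1 _ _ z
        · have hψ : (chainSplit ho (pull θ σ) : Fin (m + 1) → Fin (1 + 1)) =
              chainSplit ho σ ∘ θ := by
            funext i
            by_cases hi : σ.obj (θ i) = σ.obj 0
            · exact (chainSplit_of_eq ho (pull θ σ) (hi.trans h0.symm)).trans
                (chainSplit_of_eq ho σ hi).symm
            · refine (chainSplit_of_ne ho (pull θ σ) fun h => hi ?_).trans
                (chainSplit_of_ne ho σ hi).symm
              exact Eq.trans h h0
          rw [hψ]
          exact hee h0 ((hno _ h1).trans (hno _ hσ).symm) _ _ _ z _
      · have hne : ∀ i, σ.obj (θ i) ≠ σ.obj 0 := fun i hi =>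
          h0 (chain_eq_zero ho σ (θ.monotone (Fin.zero_le i)) hi)
        rw [hconst ((hno _ h0).trans (hno _ (hne _)).symm)]
        have hψ : ∀ i, (chainSplit ho σ ∘ θ) i = 1 := fun i => chainSplit_of_ne ho σ (hne i)
        rw [stdSimplex_map_const hψ, he₁]
        exact hx' ((hno _ (hne _)).trans (hno _ hσ).symm) _ z
  let y : K → HoLim F := fun z => ⟨fun n σ => (c n σ).comp ⟨fun p => (z, p), by fun_prop⟩,
    fun m n θ σ p => compat m n θ σ z p⟩
  exact ⟨⟨y, (HoLim.continuous_iff y).2 fun n σ => (c n σ).continuous⟩, fun z n σ p => rfl⟩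

theorem HoLim.map_apply_of_eq (y : HoLim F) {n : ℕ} {σ τ : ComposableArrows J n} (h : σ = τ)
    (g : σ.obj (Fin.last n) ⟶ τ.obj (Fin.last n)) (p) : F.map g (y.1 n σ p) = y.1 n τ p := by
  subst h
  exact map_self_apply g _

/-- A point of the homotopy limit is determined by its values at morphisms. -/
theorem HoLim.apply_eq_edge {o : J} (ho : ∀ {i j : J}, (i ⟶ j) → j = i ∨ j = o) (y : HoLim F)
    (n : ℕ) (σ : ComposableArrows J n) (p) :
    y.1 n σ p = y.1 1 (ComposableArrows.mk₁ (chainHom σ)) (stdSimplex.map (chainSplit ho σ) p) := by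
  let ρ := ComposableArrows.mk₁ (chainHom σ)
  have hobj : ∀ i, (pull (chainSplit ho σ) ρ).obj i = σ.obj i := by
    intro i
    change ρ.obj (chainSplit ho σ i) = _
    by_cases hi : σ.obj i = σ.obj 0
    · rw [chainSplit_of_eq ho σ hi, hi]
      rfl
    · rw [chainSplit_of_ne ho σ hi]
      change σ.obj (Fin.last n) = σ.obj i
      have h1 := (ho (σ.map (homOfLE (Fin.zero_le i)))).resolve_left hi
      have h2 : σ.obj (Fin.last n) ≠ σ.obj 0 := fun h =>
        hi (chain_eq_zero ho σ (Fin.le_last i) h)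
      rw [h1, (ho (chainHom σ)).resolve_left h2]
  -- In a thin category a chain is determined by its objects, so `σ` is pulled back from the single
  -- edge formed by its composite.
  have hσ : σ = pull (chainSplit ho σ) ρ :=
    CategoryTheory.Functor.ext (fun i => (hobj i).symm) fun _ _ _ => Subsingleton.elim _ _
  have h1 := y.2 n 1 (chainSplit ho σ) ρ p
  have h2 := y.map_apply_of_eq hσ (eqToHom (hobj _).symm) p
  exact (map_map_self_apply _ _ _).symm.trans ((congrArg _ h2).trans h1)

theorem HoLim.edge_vertex_zero (y : HoLim F) {i j : J} (f : i ⟶ j) :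
    y.1 1 (ComposableArrows.mk₁ f) (stdSimplex.vertex 0) = F.map f (y.proj i) := by
  have h := y.2 0 1 ⟨fun _ => 0, fun _ _ _ => le_rfl⟩ (ComposableArrows.mk₁ f)
    (stdSimplex.vertex 0)
  rw [stdSimplex.map_vertex] at h
  refine h.symm.trans (congrArg (F.map f) ?_)
  have e : ComposableArrows.mk₀ i = pull ⟨fun _ => 0, fun _ _ _ => le_rfl⟩
      (ComposableArrows.mk₁ f) := ComposableArrows.ext₀ rfl
  exact (y.map_apply_of_eq e (𝟙 i) (stdSimplex.vertex 0)).symm.trans (map_self_apply _ _)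

theorem HoLim.edge_vertex_one (y : HoLim F) {i j : J} (f : i ⟶ j) :
    y.1 1 (ComposableArrows.mk₁ f) (stdSimplex.vertex 1) = y.proj j := by
  have h := y.2 0 1 ⟨fun _ => 1, fun _ _ _ => le_rfl⟩ (ComposableArrows.mk₁ f)
    (stdSimplex.vertex 0)
  rw [stdSimplex.map_vertex] at h
  have e : ComposableArrows.mk₀ j = pull ⟨fun _ => 1, fun _ _ _ => le_rfl⟩
      (ComposableArrows.mk₁ f) := ComposableArrows.ext₀ rfl
  have h' := y.map_apply_of_eq e (𝟙 j) (stdSimplex.vertex 0)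
  exact (h.symm.trans (map_self_apply (i := j) _ _)).trans
    (h'.symm.trans (map_self_apply (i := j) _ _))

theorem HoLim.edge_of_eq (y : HoLim F) {i j : J} (f : i ⟶ j) (h : i = j) (p) :
    y.1 1 (ComposableArrows.mk₁ f) p = y.proj j := by
  subst h
  have h := y.2 1 0 ⟨fun _ => 0, fun _ _ _ => le_rfl⟩ (ComposableArrows.mk₀ i) p
  have hp := stdSimplex_map_const (θ := fun _ => 0) (c := (0 : Fin (0 + 1))) (fun _ => rfl) p
  have e : ComposableArrows.mk₁ f = pull ⟨fun _ => 0, fun _ _ _ => le_rfl⟩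
      (ComposableArrows.mk₀ i) := ComposableArrows.ext₁ rfl rfl (Subsingleton.elim _ _)
  have h' := y.map_apply_of_eq e (𝟙 i) p
  exact ((map_self_apply (i := i) _ _).symm.trans h').trans
    ((map_self_apply (i := i) _ _).symm.trans (h.trans (congrArg _ hp)))

end Cospan

theorem walkingSpan_op_hom {i j : WalkingSpanᵒᵖ} (f : i ⟶ j) :
    j = i ∨ j = op WalkingSpan.zero := by
  obtain ⟨i⟩ := i
  obtain ⟨j⟩ := j
  match i, j, f.unop with
  | _, _, .id _ => exact Or.inl rfl
  | _, _, .init _ => exact Or.inr rfl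

instance : Quiver.IsThin WalkingSpanᵒᵖ := fun _ _ =>
  ⟨fun f g => Quiver.Hom.unop_inj (Subsingleton.elim f.unop g.unop)⟩

/-- If one leg of a cospan is a weak equivalence, then so is the projection from the homotopy
limit to the source of the other leg. -/
theorem isWeakEquiv_proj_of_cospan {F : WalkingSpanᵒᵖ ⥤ TopCat.{v}}
    (h : IsWeakEquiv (F.map (WalkingSpan.Hom.snd).op)) :
    IsWeakEquiv fun y : HoLim F => y.proj (op WalkingSpan.left) := by
  suffices RelLift (⟨fun y : HoLim F => y.proj (op WalkingSpan.left),
      HoLim.continuous_proj _⟩ : C(HoLim F, F.obj (op WalkingSpan.left))) from this.isWeakEquiv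
  intro n K _ L hK u v huv
  have hf : RelLift (F.map (WalkingSpan.Hom.snd).op).hom := h.relLift
  let s : C(unitInterval, stdSimplex ℝ (Fin (1 + 1))) :=
    ⟨stdSimplexHomeomorphUnitInterval.symm, stdSimplexHomeomorphUnitInterval.symm.continuous⟩
  have s0 : s 0 = stdSimplex.vertex 0 :=
    stdSimplexHomeomorphUnitInterval.symm_apply_eq.2 rfl
  have s1 : s 1 = stdSimplex.vertex 1 :=
    stdSimplexHomeomorphUnitInterval.symm_apply_eq.2 rfl
  let s' : C(stdSimplex ℝ (Fin (1 + 1)), unitInterval) :=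
    ⟨stdSimplexHomeomorphUnitInterval, stdSimplexHomeomorphUnitInterval.continuous⟩
  have s'0 : s' (stdSimplex.vertex 0) = 0 := rfl
  have s'1 : s' (stdSimplex.vertex 1) = 1 := rfl
  have ss' : ∀ p, s (s' p) = p := fun p => stdSimplexHomeomorphUnitInterval.symm_apply_apply p
  let edge : ∀ {i j : WalkingSpanᵒᵖ}, (i ⟶ j) → C(unitInterval × L, F.obj j) := fun f =>
    ⟨fun p => (u p.2).1 1 (ComposableArrows.mk₁ f) (s p.1),
      ((HoLim.continuous_iff u).1 u.continuous 1 (ComposableArrows.mk₁ f)).comp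
        (continuous_snd.prodMk (s.continuous.comp continuous_fst))⟩
  have edge0 : ∀ {i j : WalkingSpanᵒᵖ} (f : i ⟶ j) l, edge f (0, l) = F.map f ((u l).proj i) :=
    fun f l => (congrArg _ s0).trans ((u l).edge_vertex_zero f)
  have edge1 : ∀ {i j : WalkingSpanᵒᵖ} (f : i ⟶ j) l, edge f (1, l) = (u l).proj j :=
    fun f l => (congrArg _ s1).trans ((u l).edge_vertex_one f)
  obtain ⟨H, h0, h1⟩ := hK.exists_homotopy_extension
    ((F.map (WalkingSpan.Hom.fst).op).hom.comp v) (edge (WalkingSpan.Hom.fst).op) fun l =>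
      (edge0 _ l).trans (congrArg _ (huv l))
  let x₀ : C(K, F.obj (op WalkingSpan.zero)) := H.comp ⟨fun z => (1, z), by fun_prop⟩
  have hx₀ : ∀ l : L, x₀ l = (u l).proj (op WalkingSpan.zero) := fun l =>
    (h1 1 l).trans (edge1 _ l)
  -- The other leg is a weak equivalence, so `x₀` lifts up to a homotopy that restricts over `L` to
  -- the other edge of `u`.
  obtain ⟨x₂, hx₂, H', h0', h1', h2'⟩ := hf.exists_transp hK
    (⟨fun l => (u l).proj (op WalkingSpan.right),
      (HoLim.continuous_proj _).comp u.continuous⟩ : C(L, F.obj (op WalkingSpan.right)))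
    x₀ (edge (WalkingSpan.Hom.snd).op) (fun l => edge0 _ l)
    (fun l => (edge1 _ l).trans (hx₀ l).symm)
  -- In `WalkingSpan` the constructor `none` is the vertex `zero`.
  let x : ∀ j, C(K, F.obj j) := fun j => match j with
    | ⟨none⟩ => x₀
    | ⟨some .left⟩ => v
    | ⟨some .right⟩ => x₂
  have hx : ∀ j (l : L), x j l = (u l).proj j := by
    rintro ⟨_ | _ | _⟩ l
    · exact hx₀ l
    · exact (huv l).symm
    · exact hx₂ l
  have toEdge : ∀ {i j : WalkingSpanᵒᵖ} (f : i ⟶ j) (G : C(unitInterval × K, F.obj j)),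
      (∀ z, G (0, z) = F.map f (x i z)) → (∀ z, G (1, z) = x j z) →
      (i = j → ∀ t z, G (t, z) = x j z) → (∀ t (l : L), G (t, (l : K)) = edge f (t, l)) →
      ∃ e : C(K × stdSimplex ℝ (Fin (1 + 1)), F.obj j),
        (∀ z, e (z, stdSimplex.vertex 0) = F.map f (x i z)) ∧
        (∀ z, e (z, stdSimplex.vertex 1) = x j z) ∧ (i = j → ∀ z p, e (z, p) = x j z) ∧
        ∀ (l : L) p, e ((l : K), p) = (u l).1 1 (ComposableArrows.mk₁ f) p := by
    intro i j f G g0 g1 g2 g3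
    refine ⟨G.comp ⟨fun q => (s' q.2, q.1), by fun_prop⟩, fun z => ?_, fun z => ?_,
      fun hij z p => g2 hij _ z, fun l p => ?_⟩
    · exact (congrArg (fun t => G (t, z)) s'0).trans (g0 z)
    · exact (congrArg (fun t => G (t, z)) s'1).trans (g1 z)
    · exact (g3 (s' p) l).trans (congrArg _ (ss' p))
  have hedge : ∀ (i j : WalkingSpanᵒᵖ) (f : i ⟶ j),
      ∃ e : C(K × stdSimplex ℝ (Fin (1 + 1)), F.obj j),
        (∀ z, e (z, stdSimplex.vertex 0) = F.map f (x i z)) ∧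
        (∀ z, e (z, stdSimplex.vertex 1) = x j z) ∧ (i = j → ∀ z p, e (z, p) = x j z) ∧
        ∀ (l : L) p, e ((l : K), p) = (u l).1 1 (ComposableArrows.mk₁ f) p := by
    have hself : ∀ (i : WalkingSpanᵒᵖ) (f : i ⟶ i), _ := fun i f =>
      toEdge f ((x i).comp ContinuousMap.snd) (fun z => (map_self_apply f _).symm) (fun z => rfl)
        (fun _ t z => rfl) (fun t l => (hx i l).trans ((u l).edge_of_eq f rfl _).symm)
    rintro ⟨_ | _ | _⟩ ⟨_ | _ | _⟩ f
    · exact hself _ f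
    · exact nomatch f.unop
    · exact nomatch f.unop
    · obtain rfl : f = (WalkingSpan.Hom.fst).op := Subsingleton.elim _ _
      exact toEdge (WalkingSpan.Hom.fst).op H h0 (fun z => rfl) (fun h => nomatch h) h1
    · exact hself _ f
    · exact nomatch f.unop
    · obtain rfl : f = (WalkingSpan.Hom.snd).op := Subsingleton.elim _ _
      exact toEdge (WalkingSpan.Hom.snd).op H' h0' h1' (fun h => nomatch h) h2'
    · exact nomatch f.unop
    · exact hself _ f
  choose e e0 e1 e2 e3 using hedge
  obtain ⟨y, hy⟩ := exists_hoLim_of_edges walkingSpan_op_hom x (fun f => e _ _ f)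
    (fun f => e0 _ _ f) (fun f => e1 _ _ f) (fun f => e2 _ _ f)
  refine ⟨y, fun l => HoLim.ext fun n σ p => ?_, ?_⟩
  · rw [hy, e3, ← HoLim.apply_eq_edge]
  · have : (⟨fun y : HoLim F => y.proj (op WalkingSpan.left), HoLim.continuous_proj _⟩ :
        C(HoLim F, F.obj (op WalkingSpan.left))).comp y = v := by
      ext z
      exact (hy z 0 _ _).trans (e2 _ _ _ rfl z _)
    rw [this]
    exact ContinuousMap.HomotopicRel.refl v

end SpaceLocalization

namespace SpaceLocalization

/-! ### Mapping spaces -/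

section Mapping


theorem isWeakEquiv_id (X : Type*) [TopologicalSpace X] : IsWeakEquiv fun x : X => x := by
  suffices RelLift (ContinuousMap.id X) from this.isWeakEquiv
  intro n K _ L _ u v huv
  exact ⟨v, fun l => (huv l).symm, ContinuousMap.HomotopicRel.refl v⟩

/-- A path of maps gives a homotopy between the precompositions; its continuity is checked on `I ×
K` for cells `K`, which is `T`-generated. -/
theorem isWeakEquiv_precomp_of_joined {ι : Type t} (T : ι → Type s)
    [∀ i, TopologicalSpace (T i)] [ConvenientFamily T] {C : Type u} [Category.{v} C]
    [∀ A B : C, TopologicalSpace (A ⟶ B)] [SpaceEnriched T C]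
    {A B : C} {f f' : A ⟶ B} (h : Joined f f') (Y : C)
    (hf : IsWeakEquiv fun g : B ⟶ Y => f ≫ g) : IsWeakEquiv fun g : B ⟶ Y => f' ≫ g := by
  obtain ⟨γ⟩ := h
  refine hf.of_homotopy (continuous_precomp T f' Y) (fun t g => γ t ≫ g) (by simp) (by simp) ?_
  intro n K _ L hK a
  have := (isCell_unitInterval.prod hK).isGeneratedBy T
  exact continuous_comp_of_isGeneratedBy T (γ.continuous.comp continuous_fst)
    (a.continuous.comp continuous_snd)

theorem isWeakEquiv_postcomp_of_joined {ι : Type t} (T : ι → Type s)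
    [∀ i, TopologicalSpace (T i)] [ConvenientFamily T] {C : Type u} [Category.{v} C]
    [∀ A B : C, TopologicalSpace (A ⟶ B)] [SpaceEnriched T C]
    (X : C) {A B : C} {f f' : A ⟶ B} (h : Joined f f')
    (hf : IsWeakEquiv fun g : X ⟶ A => g ≫ f) : IsWeakEquiv fun g : X ⟶ A => g ≫ f' := by
  obtain ⟨γ⟩ := h
  refine hf.of_homotopy (continuous_postcomp T X f') (fun t g => g ≫ γ t) (by simp) (by simp) ?_
  intro n K _ L hK a
  have := (isCell_unitInterval.prod hK).isGeneratedBy T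
  exact continuous_comp_of_isGeneratedBy T (a.continuous.comp continuous_snd)
    (γ.continuous.comp continuous_fst)

/-- Both composites of `f^*` and `g^*` are precompositions with maps joined to an identity. -/
theorem isWeakEquiv_precomp_of_homotopyEquiv {ι : Type t} (T : ι → Type s)
    [∀ i, TopologicalSpace (T i)] [ConvenientFamily T] {C : Type u} [Category.{v} C]
    [∀ A B : C, TopologicalSpace (A ⟶ B)] [SpaceEnriched T C]
    {A B : C} {f : A ⟶ B} {g : B ⟶ A}
    (hfg : Joined (f ≫ g) (𝟙 A)) (hgf : Joined (g ≫ f) (𝟙 B)) (Y : C) :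
    IsWeakEquiv fun h : B ⟶ Y => f ≫ h := by
  refine IsWeakEquiv.of_comp_of_comp (g := fun h : A ⟶ Y => g ≫ h) (continuous_precomp T f Y)
    (continuous_precomp T g Y) ?_ ?_
  · have h1 := isWeakEquiv_precomp_of_joined T hgf.symm Y (by
      simpa only [Category.id_comp] using isWeakEquiv_id (B ⟶ Y))
    simpa only [Function.comp_def, Category.assoc] using h1
  · have h1 := isWeakEquiv_precomp_of_joined T hfg.symm Y (by
      simpa only [Category.id_comp] using isWeakEquiv_id (A ⟶ Y))
    simpa only [Function.comp_def, Category.assoc] using h1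

theorem isWeakEquiv_postcomp_of_homotopyEquiv {ι : Type t} (T : ι → Type s)
    [∀ i, TopologicalSpace (T i)] [ConvenientFamily T] {C : Type u} [Category.{v} C]
    [∀ A B : C, TopologicalSpace (A ⟶ B)] [SpaceEnriched T C]
    (X : C) {A B : C} {f : A ⟶ B} {g : B ⟶ A}
    (hfg : Joined (f ≫ g) (𝟙 A)) (hgf : Joined (g ≫ f) (𝟙 B)) :
    IsWeakEquiv fun h : X ⟶ A => h ≫ f := by
  refine IsWeakEquiv.of_comp_of_comp (g := fun h : X ⟶ B => h ≫ g) (continuous_postcomp T X f)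
    (continuous_postcomp T X g) ?_ ?_
  · have h1 := isWeakEquiv_postcomp_of_joined T X hfg.symm (by
      simpa only [Category.comp_id] using isWeakEquiv_id (X ⟶ A))
    simpa only [Function.comp_def, ← Category.assoc] using h1
  · have h1 := isWeakEquiv_postcomp_of_joined T X hgf.symm (by
      simpa only [Category.comp_id] using isWeakEquiv_id (X ⟶ B))
    simpa only [Function.comp_def, ← Category.assoc] using h1

/-- An isomorphism of the homotopy category is represented by a homotopy equivalence. -/
theorem exists_homotopyEquiv_of_iso {ι : Type t} (T : ι → Type s)
    [∀ i, TopologicalSpace (T i)] [ConvenientFamily T] {C : Type u} [Category.{v} C]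
    [∀ A B : C, TopologicalSpace (A ⟶ B)] [SpaceEnriched T C]
    {A B : C} (e : (toHoCat T C).obj A ≅ (toHoCat T C).obj B) :
    ∃ (f : A ⟶ B) (g : B ⟶ A), (toHoCat T C).map f = e.hom ∧ Joined (f ≫ g) (𝟙 A) ∧
      Joined (g ≫ f) (𝟙 B) := by
  obtain ⟨f, hf⟩ : ∃ f : A ⟶ B, (toHoCat T C).map f = e.hom := Quotient.exists_rep e.hom
  obtain ⟨g, hg⟩ : ∃ g : B ⟶ A, (toHoCat T C).map g = e.inv := Quotient.exists_rep e.inv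
  have h1 : (toHoCat T C).map (f ≫ g) = (toHoCat T C).map (𝟙 A) := by
    rw [Functor.map_comp, hf, hg, e.hom_inv_id, CategoryTheory.Functor.map_id]
  have h2 : (toHoCat T C).map (g ≫ f) = (toHoCat T C).map (𝟙 B) := by
    rw [Functor.map_comp, hf, hg, e.inv_hom_id, CategoryTheory.Functor.map_id]
  exact ⟨f, g, hf, Quotient.exact h1, Quotient.exact h2⟩

end Mapping

/-! ### Closure properties of local objects and local equivalences -/

section LocalClosure

variable {ι : Type t} (T : ι → Type s) [∀ i, TopologicalSpace (T i)]
  {C : Type u} [Category.{v} C] [∀ A B : C, TopologicalSpace (A ⟶ B)] [SpaceEnriched T C]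
  {S : MorphismProperty C}

/-- In the naturality square of `f^*` and the comparison maps to `holim Map(-, Y_j)`, the other
three sides are weak equivalences. -/
theorem IsHoLim.isLocal {J : Type w} [Category.{w'} J] {Y : J ⥤ C} {L : C} {c : HoCone T Y L}
    (hc : IsHoLim c) (hY : ∀ j, IsLocal S (Y.obj j)) : IsLocal S L := by
  intro A B f hf
  have h1 : IsWeakEquiv (HoLim.map (Functor.whiskerLeft Y ((mapSpace T C).map f.op))) :=
    isWeakEquiv_hoLimMap fun j => hY j f hf
  refine IsWeakEquiv.of_comp_left (continuous_precomp T f L) (hc A) ?_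
  have h2 : (c.precomp A ∘ fun g : B ⟶ L => f ≫ g) =
      HoLim.map (Functor.whiskerLeft Y ((mapSpace T C).map f.op)) ∘ c.precomp B := by
    funext g
    refine HoLim.ext fun n σ p => ?_
    exact Category.assoc f g _
  rw [h2]
  exact h1.comp (hc B)

theorem IsHoColim.exists_isInducedMap {I : Type w} [Category.{w'} I] {A B : I ⥤ C} (α : A ⟶ B)
    {LA LB : C} {a : HoCocone T A LA} (b : HoCocone T B LB) (ha : IsHoColim a) :
    ∃ f : LA ⟶ LB, IsInducedMap α a b f :=
  ((bijective_piZeroMap_iff _).1 (ha LB).bijective_piZero).2 (b.restrict α)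

/-- The map `f'^*` is the equivalence from `Map(B', Y)` to the homotopy limit of `Map(A', Y) →
Map(A, Y) ← Map(B, Y)`, followed by the projection to `Map(A', Y)`. -/
theorem IsHoPushout.isLocalEquiv {A B A' B' : C} {f : A ⟶ B} {g : A ⟶ A'} {f' : A' ⟶ B'}
    {g' : B ⟶ B'} (h : IsHoPushout T f g f' g') (hf : IsLocalEquiv S f) : IsLocalEquiv S f' := by
  obtain ⟨c, hc, rfl, -⟩ := h
  intro Y hY
  have h1 := isWeakEquiv_proj_of_cospan
    (F := (span g f).op ⋙ (mapSpace T C).flip.obj Y) (hf Y hY)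
  exact h1.comp (hc Y)

variable [ConvenientFamily T]

theorem IsLocal.of_hoIso {X Y : C} (e : (toHoCat T C).obj X ≅ (toHoCat T C).obj Y)
    (hX : IsLocal S X) : IsLocal S Y := by
  obtain ⟨φ, ψ, -, h1, h2⟩ := exists_homotopyEquiv_of_iso T e
  intro A B f hf
  have hB := isWeakEquiv_postcomp_of_homotopyEquiv T B h1 h2
  have hA := isWeakEquiv_postcomp_of_homotopyEquiv T A h1 h2
  refine IsWeakEquiv.of_comp_right (continuous_precomp T f Y) hB ?_
  have := hA.comp (hX f hf)
  simpa only [Function.comp_def, Category.assoc] using this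

theorem IsLocalEquiv.of_hoIso {A B A' B' : C} {f : A ⟶ B} {f' : A' ⟶ B'}
    (e : Arrow.mk ((toHoCat T C).map f) ≅ Arrow.mk ((toHoCat T C).map f'))
    (hf : IsLocalEquiv S f) : IsLocalEquiv S f' := by
  obtain ⟨φ, φ', hφ, h1, h2⟩ := exists_homotopyEquiv_of_iso T (A := A) (B := A') (Arrow.leftFunc.mapIso e)
  obtain ⟨ψ, ψ', hψ, h3, h4⟩ := exists_homotopyEquiv_of_iso T (A := B) (B := B') (Arrow.rightFunc.mapIso e)
  have hj : Joined (f ≫ ψ) (φ ≫ f') := by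
    have : (toHoCat T C).map (f ≫ ψ) = (toHoCat T C).map (φ ≫ f') := by
      rw [Functor.map_comp, Functor.map_comp, hφ, hψ]
      exact (Arrow.w_mk_right e.hom).symm
    exact Quotient.exact this
  intro Y hY
  have hψY := isWeakEquiv_precomp_of_homotopyEquiv T h3 h4 Y
  have hφY := isWeakEquiv_precomp_of_homotopyEquiv T h1 h2 Y
  refine IsWeakEquiv.of_comp_left (continuous_precomp T f' Y) hφY ?_
  have := (hf Y hY).comp hψY
  have := isWeakEquiv_precomp_of_joined T hj Y (by
    simpa only [Function.comp_def, Category.assoc] using this)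
  simpa only [Function.comp_def, Category.assoc] using this

theorem IsInducedMap.isLocalEquiv {I : Type w} [Category.{w'} I] {A B : I ⥤ C} {α : A ⟶ B}
    {LA LB : C} {a : HoCocone T A LA} {b : HoCocone T B LB} (ha : IsHoColim a) (hb : IsHoColim b)
    (hα : ∀ i, IsLocalEquiv S (α.app i)) {f : LA ⟶ LB} (hf : IsInducedMap α a b f) :
    IsLocalEquiv S f := by
  intro Y hY
  have h1 : IsWeakEquiv (HoLim.map
      (Functor.whiskerRight (NatTrans.op α) ((mapSpace T C).flip.obj Y))) :=
    isWeakEquiv_hoLimMap fun i => hα i.unop Y hY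
  have h2 := h1.comp (hb Y)
  refine IsWeakEquiv.of_comp_left (continuous_precomp T f Y) (ha Y) ?_
  -- The path is reversed because the homotopy must start at the map already known to be a weak
  -- equivalence, the restriction along `α` after the comparison map of `b`.
  obtain ⟨γ⟩ := Joined.symm hf
  refine h2.of_homotopy ((ha Y).continuous.comp (continuous_precomp T f Y))
    (fun t g => HoCocone.postcomp (γ t) Y g) (fun g => ?_) (fun g => ?_) ?_
  · refine HoLim.ext fun n σ p => ?_
    rw [γ.source]
    exact Category.assoc _ _ _
  · refine HoLim.ext fun n σ p => ?_
    rw [γ.target]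
    exact Category.assoc _ _ _
  · intro n K _ L hK w
    rw [HoLim.continuous_iff]
    intro m σ
    have := ((isCell_unitInterval.prod hK).prod (isCell_stdSimplex m)).isGeneratedBy T
    refine continuous_comp_of_isGeneratedBy T (K := (unitInterval × K) × stdSimplex ℝ (Fin (m + 1)))
      (p := fun p => (γ p.1.1).1 m σ p.2) (q := fun p => w p.1.2) ?_ ?_
    · exact ((HoLim.continuous_iff γ).1 γ.continuous m σ).comp
        ((continuous_fst.comp continuous_fst).prodMk continuous_snd)
    · exact w.continuous.comp (continuous_snd.comp continuous_fst)

end LocalClosure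

theorem IsLocalEquiv.comp {C : Type u} [Category.{v} C]
    [∀ A B : C, TopologicalSpace (A ⟶ B)] {S : MorphismProperty C} {A B D : C} {f : A ⟶ B} {g : B ⟶ D} (hf : IsLocalEquiv S f)
    (hg : IsLocalEquiv S g) : IsLocalEquiv S (f ≫ g) := fun Y hY => by
  have := (hf Y hY).comp (hg Y hY)
  simpa only [Function.comp_def, Category.assoc] using this

/-- Precomposition reverses the order: `(f ≫ g)^* = f^* ∘ g^*`, so `f^*` is the outer map that is
cancelled. -/
theorem IsLocalEquiv.of_comp_left {ι : Type t} (T : ι → Type s)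
    [∀ i, TopologicalSpace (T i)] {C : Type u} [Category.{v} C]
    [∀ A B : C, TopologicalSpace (A ⟶ B)] [SpaceEnriched T C]
    {S : MorphismProperty C} {A B D : C} {f : A ⟶ B} {g : B ⟶ D} (hf : IsLocalEquiv S f)
    (hfg : IsLocalEquiv S (f ≫ g)) : IsLocalEquiv S g := fun Y hY => by
  refine IsWeakEquiv.of_comp_left (continuous_precomp T g Y) (hf Y hY) ?_
  simpa only [Function.comp_def, Category.assoc] using hfg Y hY

theorem IsLocalEquiv.of_comp_right {ι : Type t} (T : ι → Type s)
    [∀ i, TopologicalSpace (T i)] {C : Type u} [Category.{v} C]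
    [∀ A B : C, TopologicalSpace (A ⟶ B)] [SpaceEnriched T C]
    {S : MorphismProperty C} {A B D : C} {f : A ⟶ B} {g : B ⟶ D} (hg : IsLocalEquiv S g)
    (hfg : IsLocalEquiv S (f ≫ g)) : IsLocalEquiv S f := fun Y hY => by
  refine IsWeakEquiv.of_comp_right (continuous_precomp T f Y) (hg Y hY) ?_
  simpa only [Function.comp_def, Category.assoc] using hfg Y hY

end SpaceLocalization

end

theorem mainTheorem3 {ι : Type t} (T : ι → Type s) [∀ i, TopologicalSpace (T i)]
    [ConvenientFamily T] {C : Type u} [Category.{v} C] [∀ A B : C, TopologicalSpace (A ⟶ B)]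
    [SpaceEnriched T C] (S : MorphismProperty C) :
    -- local objects are closed under equivalence in the homotopy category
    (∀ X Y : C, Nonempty ((toHoCat T C).obj X ≅ (toHoCat T C).obj Y) →
      IsLocal S X → IsLocal S Y) ∧
    -- local equivalences are closed under equivalence in the homotopy category
    (∀ (A B A' B' : C) (f : A ⟶ B) (f' : A' ⟶ B'),
      Nonempty (Arrow.mk ((toHoCat T C).map f) ≅ Arrow.mk ((toHoCat T C).map f')) →
      IsLocalEquiv S f → IsLocalEquiv S f') ∧
    -- local objects are closed under homotopy limits
    (∀ (J : Type w) [Category.{w'} J] (Y : J ⥤ C) (L : C) (c : HoCone T Y L), IsHoLim c →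
      (∀ j, IsLocal S (Y.obj j)) → IsLocal S L) ∧
    -- local equivalences are closed under homotopy colimits
    (∀ (I : Type w) [Category.{w'} I] (A B : I ⥤ C) (α : A ⟶ B) (LA LB : C)
      (a : HoCocone T A LA) (b : HoCocone T B LB), IsHoColim a → IsHoColim b →
      (∀ i, IsLocalEquiv S (α.app i)) →
      (∃ f : LA ⟶ LB, IsInducedMap α a b f) ∧
      ∀ f : LA ⟶ LB, IsInducedMap α a b f → IsLocalEquiv S f) ∧
    -- homotopy pushouts of local equivalences are local equivalences
    (∀ (A B A' B' : C) (f : A ⟶ B) (g : A ⟶ A') (f' : A' ⟶ B') (g' : B ⟶ B'),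
      IsHoPushout T f g f' g' → IsLocalEquiv S f → IsLocalEquiv S f') ∧
    -- local equivalences satisfy two-out-of-three
    (∀ (A B D : C) (f : A ⟶ B) (g : B ⟶ D),
      (IsLocalEquiv S f → IsLocalEquiv S g → IsLocalEquiv S (f ≫ g)) ∧
      (IsLocalEquiv S f → IsLocalEquiv S (f ≫ g) → IsLocalEquiv S g) ∧
      (IsLocalEquiv S g → IsLocalEquiv S (f ≫ g) → IsLocalEquiv S f)) := by
  refine ⟨fun X Y ⟨e⟩ h => h.of_hoIso T e, fun A B A' B' f f' ⟨e⟩ h => h.of_hoIso T e,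
    fun J _ Y L c hc hY => hc.isLocal T hY,
    fun I _ A B α LA LB a b ha hb hα => ⟨IsHoColim.exists_isInducedMap T α b ha,
      fun f hf => IsInducedMap.isLocalEquiv T ha hb hα hf⟩,
    fun A B A' B' f g f' g' h hf => h.isLocalEquiv T hf,
    fun A B D f g => ⟨fun hf hg => hf.comp hg, fun hf hfg => hf.of_comp_left T hfg,
      fun hg hfg => hg.of_comp_right T hfg⟩⟩
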